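/- For a matrix $F$, $|F|$ is the Euclidean (Frobenius) norm, and $|E|$ is the Lebesgue measure of a set $E$. Gradients are weak gradients of locally integrable functions. A bounded Lipschitz domain is a nonempty, bounded, connected open set which near each of its boundary points coincides, in suitable orthonormal coordinates, with the region strictly above the graph of a Lipschitz function. (i) Let $1<p<\infty$, let $n\ge 2$ and $m\ge 1$ be integers, and let $\Omega$ be a bounded Lipschitz domain in $\mathbb R^n$ or $\Omega=\mathbb R^n$. There is a constant $C>0$, depending only on $\Omega,p,n,m$, such that for all $A>a>0$ and every locally integrable $v:\Omega\to\mathbb R^m$ with $\nabla v\in L^p(\Omega;\mathbb R^{m\times n})$ there exist $\lambda\in[a,A]$ and a function $v^\lambda:\Omega\to\mathbb R^m$ which is $\lambda$-Lipschitz on $\Omega$ and satisfies $$|\nabla v^\lambda|\le\lambda\quad\text{a.e. in }\Omega,\qquad \lambda^p\,|\{x\in\Omega: v^\lambda(x)\ne v(x)\}|\le\frac{C}{\ln(A/a)}\int_\Omega|\nabla v|^p\,dx .$$ (ii) Let $L>0$ and, for $h>0$, let $\Omega_h=(0,L)\times(-\tfrac h2,\tfrac h2)\subset\mathbb R^2$.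 There is a constant $C>0$ (which may depend on $L$, but not on $h$) such that for all $h>0$, all $A>a>0$ and every $u\in W^{1,2}(\Omega_h;\mathbb R^2)$ there exist $\lambda\in[a,A]$ and a function $v\in W^{1,\infty}(\Omega_h;\mathbb R^2)$ which is $\lambda$-Lipschitz on $\Omega_h$ and satisfies $$\|\nabla v\|_{L^\infty(\Omega_h)}\le\lambda,\qquad \lambda^2\,|\{x\in\Omega_h: u(x)\ne v(x)\}|\le\frac{C}{\ln(A/a)}\int_{\Omega_h}|\nabla u|^2\,dx .$$ -/

import Mathlib

open MeasureTheory
open scoped ContDiff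

/-- A bounded Lipschitz domain in `ℝⁿ`: a nonempty connected bounded open set which near each of
its boundary points lies strictly above the graph of a Lipschitz function in suitable orthonormal
coordinates. Here `e` is the unit vector of the vertical axis, `inner ℝ e y` the height of `y`, and
`y - inner ℝ e y • e` the orthogonal projection of `y` onto the hyperplane `e^⊥`; only the values
of `γ` on that hyperplane matter. -/
structure IsBoundedLipschitzDomain {n : ℕ} (Ω : Set (EuclideanSpace ℝ (Fin n))) : Prop where
  isOpen : IsOpen Ω
  isConnected : IsConnected Ω
  isBounded : Bornology.IsBounded Ω
  locally_graph : ∀ x₀ ∈ frontier Ω,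
    ∃ (e : EuclideanSpace ℝ (Fin n)) (γ : EuclideanSpace ℝ (Fin n) → ℝ) (K : NNReal) (r : ℝ),
      ‖e‖ = 1 ∧ LipschitzWith K γ ∧ 0 < r ∧
        ∀ y ∈ Metric.ball x₀ r, (y ∈ Ω ↔ γ (y - inner ℝ e y • e) < inner ℝ e y)

/-- `G` is the weak (distributional) gradient on the open set `Ω` of the locally integrable map `v`:
the entry `G x (i, j)` is the weak partial derivative of the component `v_i` in the direction `j`.
The `m × n` matrix `G x` is an element of `EuclideanSpace ℝ (Fin m × Fin n)`, so that `‖G x‖` is its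
Euclidean (Frobenius) norm. -/
structure HasWeakGradient {n m : ℕ} (Ω : Set (EuclideanSpace ℝ (Fin n)))
    (v : EuclideanSpace ℝ (Fin n) → EuclideanSpace ℝ (Fin m))
    (G : EuclideanSpace ℝ (Fin n) → EuclideanSpace ℝ (Fin m × Fin n)) : Prop where
  locallyIntegrableOn : LocallyIntegrableOn v Ω volume
  locallyIntegrableOn_gradient : LocallyIntegrableOn G Ω volume
  integral_eq : ∀ φ : EuclideanSpace ℝ (Fin n) → ℝ,
    ContDiff ℝ ∞ φ → HasCompactSupport φ → tsupport φ ⊆ Ω →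
      ∀ (i : Fin m) (j : Fin n),
        ∫ x in Ω, v x i * fderiv ℝ φ x (EuclideanSpace.single j 1) = - ∫ x in Ω, G x (i, j) * φ x

/-- The strip `(0, L) × (-h/2, h/2)` in `ℝ²`. -/
def thinStrip (L h : ℝ) : Set (EuclideanSpace ℝ (Fin 2)) :=
  {x | 0 < x 0 ∧ x 0 < L ∧ -(h / 2) < x 1 ∧ x 1 < h / 2}

/-! Let F = |∇v|, extended by zero, and let the maximal function of F be the supremum of its
averages over centred balls, possibly with respect to Lebesgue measure restricted to a convex set T
⊇ Ω. The argument has two halves.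

Pointwise estimate. Mollification transfers the Poincaré inequality on convex sets from C¹ functions
to weakly differentiable ones (`hasConvexPoincare_of_weak`). At a Lebesgue point x, telescoping over
sets shrinking to x sums the Poincaré bounds geometrically. So, off a null set, |u x - u y| ≤ B Λ |x
- y| whenever the maximal function is at most Λ at x and y (`HasHajlaszBound`). On a convex Ω the
sets are balls intersected with Ω and T = Ω (`Convex.hasHajlaszBound`). A homothety shows that the
restricted measure is doubling with a constant depending only on the dimension; this gives
uniformity in h for thin strips. On a bounded Lipschitz domain the sets are balls along interior
cones and T is the whole space; compactness and connectedness handle distant points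
(`exists_hasHajlaszBound_of_localCone`).

Choice of the level. McShane extension from the set where the maximal function is at most a multiple
of s gives an s-Lipschitz map, wrong only on a bad set E_s and a null set. The weak type inequality
that sees only large values reads c s |E_s| ≤ D ∫_{F > c s} F. Multiplying by s^(p-2) and
integrating over [a, A], Fubini bounds ∫ s^p |E_s| ds/s by a multiple of ∫ F^p. Since ∫ ds/s =
ln(A/a), some level achieves the claimed bound (`exists_level`). The halves meet in
`exists_lipschitz_truncation`. -/

open Set Metric Module
open scoped ENNReal

/-! ### Poincaré inequality on convex sets for C¹ functions -/

section SmoothPoincare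

variable {E : Type*} [NormedAddCommGroup E] [NormedSpace ℝ E] [FiniteDimensional ℝ E]
  [MeasurableSpace E] [BorelSpace E] (μ : Measure E) [μ.IsAddHaarMeasure]

theorem lintegral_comp_smul_addHaar {f : E → ℝ≥0∞} (hf : Measurable f) {t : ℝ} (ht : t ≠ 0) :
    ∫⁻ x, f (t • x) ∂μ = ENNReal.ofReal |(t ^ finrank ℝ E)⁻¹| * ∫⁻ x, f x ∂μ := by
  have h := lintegral_map (μ := μ) hf (measurable_const_smul t)
  rw [← h, Measure.map_addHaar_smul μ ht, lintegral_smul_measure, smul_eq_mul]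

theorem lintegral_comp_segment {f : E → ℝ≥0∞} (hf : Measurable f) {t : ℝ} (ht : t ≠ 0) (y : E) :
    ∫⁻ z, f (y + t • (z - y)) ∂μ = ENNReal.ofReal |(t ^ finrank ℝ E)⁻¹| * ∫⁻ x, f x ∂μ := by
  have h1 : ∀ z, f (y + t • (z - y)) = (fun w => f (w + (y - t • y))) (t • z) := by
    intro z
    simp only
    congr 1
    module
  rw [lintegral_congr h1, lintegral_comp_smul_addHaar μ
    (f := fun w => f (w + (y - t • y))) (by fun_prop) ht, lintegral_add_right_eq_self]

theorem ofReal_abs_inv_pow_le {t : ℝ} (ht : 1 / 2 ≤ t) (d : ℕ) :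
    ENNReal.ofReal |(t ^ d)⁻¹| ≤ 2 ^ d := by
  have h2 : (2 : ℝ≥0∞) ^ d = ENNReal.ofReal (2 ^ d) := by
    rw [ENNReal.ofReal_pow (by norm_num)]; norm_num
  rw [h2]
  apply ENNReal.ofReal_le_ofReal
  have ht0 : 0 < t := by linarith
  rw [abs_of_nonneg (by positivity), ← inv_pow]
  gcongr
  rw [inv_le_comm₀ ht0 (by norm_num)]
  linarith

/-- The substitution z ↦ y + t(z - y) has Jacobian t^d, which is harmless for t ≥ 1/2. For smaller t
the roles of y and z are exchanged, replacing t by 1 - t. The bound is therefore uniform in t and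
can be integrated along segments. -/
theorem lintegral_lintegral_segment_le {f : E → ℝ≥0∞} (hf : Measurable f) {K : Set E}
    (t : ℝ) :
    ∫⁻ y in K, ∫⁻ z in K, f (y + t • (z - y)) ∂μ ∂μ ≤ 2 ^ finrank ℝ E * μ K * ∫⁻ x, f x ∂μ := by
  have key : ∀ t : ℝ, 1 / 2 ≤ t →
      ∫⁻ y in K, ∫⁻ z in K, f (y + t • (z - y)) ∂μ ∂μ ≤
        2 ^ finrank ℝ E * μ K * ∫⁻ x, f x ∂μ := by
    intro t ht
    calc ∫⁻ y in K, ∫⁻ z in K, f (y + t • (z - y)) ∂μ ∂μ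
        ≤ ∫⁻ y in K, 2 ^ finrank ℝ E * ∫⁻ x, f x ∂μ ∂μ := by
          refine lintegral_mono fun y => ?_
          refine (setLIntegral_le_lintegral _ _).trans ?_
          rw [lintegral_comp_segment μ hf (by linarith)]
          gcongr
          exact ofReal_abs_inv_pow_le ht _
      _ = 2 ^ finrank ℝ E * μ K * ∫⁻ x, f x ∂μ := by
          rw [setLIntegral_const]; ring
  rcases le_total (1 / 2) t with ht | ht
  · exact key t ht
  · rw [lintegral_lintegral_swap (by
      apply Measurable.aemeasurable
      apply hf.comp
      fun_prop)]
    refine le_trans (le_of_eq ?_) (key (1 - t) (by linarith))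
    refine lintegral_congr fun y => lintegral_congr fun z => ?_
    congr 1
    module

omit [FiniteDimensional ℝ E] [MeasurableSpace E] [BorelSpace E] in
theorem enorm_sub_le_lintegral_fderiv {u : E → ℝ} (hu : ContDiff ℝ 1 u) (y z : E) :
    ‖u y - u z‖ₑ ≤ ∫⁻ t in Ioc (0 : ℝ) 1, ‖fderiv ℝ u (y + t • (z - y))‖ₑ * ‖z - y‖ₑ := by
  have hc : Continuous fun t : ℝ => fderiv ℝ u (y + t • (z - y)) (z - y) :=
    ((hu.continuous_fderiv one_ne_zero).comp (by fun_prop)).clm_apply continuous_const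
  have hd : ∀ t : ℝ, HasDerivAt (fun t : ℝ => u (y + t • (z - y)))
      (fderiv ℝ u (y + t • (z - y)) (z - y)) t := by
    intro t
    have h1 : HasDerivAt (fun t : ℝ => y + t • (z - y)) (z - y) t := by
      simpa using ((hasDerivAt_id t).smul_const (z - y)).const_add y
    exact ((hu.differentiable one_ne_zero).differentiableAt.hasFDerivAt).comp_hasDerivAt t h1
  have hi := intervalIntegral.integral_eq_sub_of_hasDerivAt (a := 0) (b := 1)
    (fun t _ => hd t) (hc.intervalIntegrable _ _)
  have h2 : u z - u y = ∫ t in Ioc (0 : ℝ) 1, fderiv ℝ u (y + t • (z - y)) (z - y) := by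
    rw [← intervalIntegral.integral_of_le zero_le_one, hi]
    simp
  rw [← enorm_neg, neg_sub, h2]
  refine (enorm_integral_le_lintegral_enorm _).trans (lintegral_mono fun t => ?_)
  exact ContinuousLinearMap.le_opENorm _ _

/-- The Poincaré inequality on a convex set, for `C¹` functions. -/
theorem lintegral_lintegral_enorm_sub_le_of_contDiff {u : E → ℝ} (hu : ContDiff ℝ 1 u)
    {K : Set E} (hK : Convex ℝ K) (hKm : MeasurableSet K) {R : ℝ≥0∞}
    (hR : ∀ y ∈ K, ∀ z ∈ K, ‖z - y‖ₑ ≤ R) :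
    ∫⁻ y in K, ∫⁻ z in K, ‖u y - u z‖ₑ ∂μ ∂μ ≤
      2 ^ finrank ℝ E * R * μ K * ∫⁻ x in K, ‖fderiv ℝ u x‖ₑ ∂μ := by
  set g : E → ℝ≥0∞ := K.indicator fun x => ‖fderiv ℝ u x‖ₑ with hg
  have hgm : Measurable g :=
    ((hu.continuous_fderiv one_ne_zero).enorm.measurable).indicator hKm
  have hpt : ∀ y ∈ K, ∀ z ∈ K,
      ‖u y - u z‖ₑ ≤ ∫⁻ t in Ioc (0 : ℝ) 1, R * g (y + t • (z - y)) := by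
    intro y hy z hz
    refine (enorm_sub_le_lintegral_fderiv hu y z).trans ?_
    refine setLIntegral_mono' measurableSet_Ioc fun t ht => ?_
    have hmem : y + t • (z - y) ∈ K := hK.add_smul_sub_mem hy hz ⟨ht.1.le, ht.2⟩
    rw [hg, indicator_of_mem hmem, mul_comm]
    gcongr
    exact hR y hy z hz
  calc ∫⁻ y in K, ∫⁻ z in K, ‖u y - u z‖ₑ ∂μ ∂μ
      ≤ ∫⁻ y in K, ∫⁻ z in K, (∫⁻ t in Ioc (0 : ℝ) 1, R * g (y + t • (z - y))) ∂μ ∂μ :=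
        setLIntegral_mono' hKm fun y hy => setLIntegral_mono' hKm fun z hz => hpt y hy z hz
    _ = ∫⁻ y in K, (∫⁻ t in Ioc (0 : ℝ) 1, ∫⁻ z in K, R * g (y + t • (z - y)) ∂μ) ∂μ := by
        refine lintegral_congr fun y => ?_
        rw [lintegral_lintegral_swap]
        apply Measurable.aemeasurable
        refine Measurable.const_mul (hgm.comp ?_) R
        fun_prop
    _ = ∫⁻ t in Ioc (0 : ℝ) 1, ∫⁻ y in K, ∫⁻ z in K, R * g (y + t • (z - y)) ∂μ ∂μ := by
        rw [lintegral_lintegral_swap]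
        apply Measurable.aemeasurable
        apply Measurable.lintegral_prod_right' (f := fun q : (E × ℝ) × E =>
          R * g (q.1.1 + q.1.2 • (q.2 - q.1.1)))
        refine Measurable.const_mul (hgm.comp ?_) R
        fun_prop
    _ ≤ ∫⁻ t in Ioc (0 : ℝ) 1, R * (2 ^ finrank ℝ E * μ K * ∫⁻ x, g x ∂μ) := by
        refine lintegral_mono fun t => ?_
        have hm : ∀ y, Measurable fun z => g (y + t • (z - y)) := fun y =>
          hgm.comp (by fun_prop)
        have hm2 : Measurable fun y => ∫⁻ z in K, g (y + t • (z - y)) ∂μ := by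
          apply Measurable.lintegral_prod_right' (f := fun q : E × E => g (q.1 + t • (q.2 - q.1)))
          exact hgm.comp (by fun_prop)
        simp_rw [lintegral_const_mul R (hm _)]
        rw [lintegral_const_mul R hm2]
        gcongr
        exact lintegral_lintegral_segment_le μ hgm t
    _ = 2 ^ finrank ℝ E * R * μ K * ∫⁻ x in K, ‖fderiv ℝ u x‖ₑ ∂μ := by
        rw [setLIntegral_const, hg, lintegral_indicator hKm]
        simp only [Real.volume_Ioc, sub_zero, ENNReal.ofReal_one, mul_one]
        ring

end SmoothPoincare

/-- `u` satisfies the Poincaré inequality with density `F` and constant `C` on all bounded open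
convex subsets of `Ω`. -/
def HasConvexPoincare {E : Type*} [NormedAddCommGroup E] [NormedSpace ℝ E] [MeasurableSpace E]
    (μ : Measure E) (C : ℝ≥0∞) (Ω : Set E) (u : E → ℝ) (F : E → ℝ≥0∞) : Prop :=
  ∀ (K : Set E) (x : E) (R : ℝ), IsOpen K → Convex ℝ K → K ⊆ Ω → K ⊆ closedBall x R →
    ∫⁻ y in K, ∫⁻ z in K, ‖u y - u z‖ₑ ∂μ ∂μ ≤ C * ENNReal.ofReal R * μ K * ∫⁻ y in K, F y ∂μ

/-! ### From smooth to weakly differentiable functions -/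

section Mollification

open Convolution ContinuousLinearMap Filter Topology

variable {n : ℕ}

local notation "𝔼" => EuclideanSpace ℝ (Fin n)

theorem enorm_clm_le_sum (L : 𝔼 →L[ℝ] ℝ) :
    ‖L‖ₑ ≤ ∑ j, ‖L (EuclideanSpace.single j 1)‖ₑ := by
  have h : ‖L‖ ≤ ∑ j, ‖L (EuclideanSpace.single j 1)‖ := by
    refine L.opNorm_le_bound (Finset.sum_nonneg fun _ _ => norm_nonneg _) fun x => ?_
    have hx : x = ∑ j, x j • EuclideanSpace.single j (1 : ℝ) := by
      ext i
      simp [Pi.single_apply]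
    conv_lhs => rw [hx, map_sum]
    refine (norm_sum_le _ _).trans ?_
    rw [Finset.sum_mul]
    refine Finset.sum_le_sum fun j _ => ?_
    rw [map_smul, norm_smul, mul_comm]
    gcongr
    exact PiLp.norm_apply_le x j
  calc ‖L‖ₑ = ENNReal.ofReal ‖L‖ := (ofReal_norm L).symm
    _ ≤ ENNReal.ofReal (∑ j, ‖L (EuclideanSpace.single j 1)‖) := ENNReal.ofReal_le_ofReal h
    _ = ∑ j, ‖L (EuclideanSpace.single j 1)‖ₑ := by
        rw [ENNReal.ofReal_sum_of_nonneg fun _ _ => norm_nonneg _]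
        simp_rw [ofReal_norm]

/-- The gradient of a mollified function is controlled by the mollified weak gradient. -/
theorem enorm_fderiv_convolution_le {Ω Q : Set 𝔼} {u : 𝔼 → ℝ} {g : Fin n → 𝔼 → ℝ}
    {F : 𝔼 → ℝ≥0∞} (hF : ∀ j, ∀ x ∈ Ω, ‖g j x‖ₑ ≤ F x) (hΩ : MeasurableSet Ω)
    (hweak : ∀ φ : 𝔼 → ℝ, ContDiff ℝ ∞ φ → HasCompactSupport φ → tsupport φ ⊆ Ω → ∀ j,
      ∫ x in Ω, u x * fderiv ℝ φ x (EuclideanSpace.single j 1) = - ∫ x in Ω, g j x * φ x)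
    (hQΩ : Q ⊆ Ω) (hu : Integrable (Q.indicator u))
    {ρ : 𝔼 → ℝ} (hρ : ContDiff ℝ ∞ ρ) {ε : ℝ} (hρs : tsupport ρ ⊆ closedBall 0 ε)
    {x : 𝔼} (hx : closedBall x ε ⊆ Q) :
    ‖fderiv ℝ (Q.indicator u ⋆[lsmul ℝ ℝ, volume] ρ) x‖ₑ ≤
      n * ∫⁻ t, ‖ρ (x - t)‖ₑ * F t := by
  have hρc : HasCompactSupport ρ := (isCompact_closedBall 0 ε).of_isClosed_subset
    (isClosed_tsupport _) hρs
  have hρ1 : ContDiff ℝ 1 ρ := hρ.of_le (by exact_mod_cast le_top)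
  have hder := hρc.hasFDerivAt_convolution_right (lsmul ℝ ℝ) (μ := volume)
    hu.locallyIntegrable hρ1 x
  -- The reflected mollifier centred at x is an admissible test function because its support lies in
  -- `closedBall x ε ⊆ Q ⊆ Ω`; the reflection supplies the minus sign in the weak identity.
  set φ : 𝔼 → ℝ := fun t => ρ (x - t) with hφ
  have hφs : ContDiff ℝ ∞ φ := hρ.comp (contDiff_const.sub contDiff_id)
  have hzero : ∀ t, t ∉ closedBall x ε → φ t = 0 := by
    intro t ht
    refine image_eq_zero_of_notMem_tsupport (f := ρ) fun hmem => ?_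
    apply ht
    have := hρs hmem
    rw [mem_closedBall, dist_zero_right] at this
    rw [mem_closedBall, dist_comm, dist_eq_norm]
    exact this
  have hφt : tsupport φ ⊆ closedBall x ε :=
    closure_minimal (fun t ht => by by_contra h; exact ht (hzero t h)) isClosed_closedBall
  have hφc : HasCompactSupport φ := (isCompact_closedBall x ε).of_isClosed_subset
    (isClosed_tsupport _) hφt
  have hφd : ∀ t e, fderiv ℝ φ t e = - fderiv ℝ ρ (x - t) e := by
    intro t e
    have h1 : HasFDerivAt φ ((fderiv ℝ ρ (x - t)).comp (-ContinuousLinearMap.id ℝ 𝔼)) t := by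
      apply HasFDerivAt.comp
      · exact (hρ1.differentiable one_ne_zero).differentiableAt.hasFDerivAt
      · simpa using (hasFDerivAt_id t).const_sub x
    rw [h1.fderiv]
    simp
  have hφd0 : ∀ t e, t ∉ closedBall x ε → fderiv ℝ φ t e = 0 := by
    intro t e ht
    have : fderiv ℝ φ t = 0 :=
      image_eq_zero_of_notMem_tsupport fun h => ht (hφt (tsupport_fderiv_subset ℝ h))
    rw [this]; rfl
  have hcomp : ∀ j, ‖fderiv ℝ (Q.indicator u ⋆[lsmul ℝ ℝ, volume] ρ) x
      (EuclideanSpace.single j 1)‖ₑ ≤ ∫⁻ t, ‖ρ (x - t)‖ₑ * F t := by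
    intro j
    rw [hder.fderiv, convolution_precompR_apply _ hu.locallyIntegrable (hρc.fderiv ℝ)
      (hρ1.continuous_fderiv one_ne_zero)]
    have h2 : (Q.indicator u ⋆[lsmul ℝ ℝ, volume]
        fun a => fderiv ℝ ρ a (EuclideanSpace.single j 1)) x =
        ∫ t in Ω, g j t * φ t := by
      rw [← neg_neg (∫ t in Ω, g j t * φ t), ← hweak φ hφs hφc ((hφt.trans hx).trans hQΩ) j,
        ← integral_neg, ← integral_indicator hΩ, convolution_def]
      congr 1
      ext t
      simp only [lsmul_apply, smul_eq_mul]
      by_cases ht : t ∈ closedBall x ε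
      · rw [indicator_of_mem (hx ht), indicator_of_mem (hQΩ (hx ht)), hφd]
        ring
      · have h3 := hφd t (EuclideanSpace.single j 1)
        rw [hφd0 t _ ht] at h3
        have h4 : fderiv ℝ ρ (x - t) (EuclideanSpace.single j 1) = 0 := by linarith
        rw [h4, mul_zero]
        by_cases h5 : t ∈ Ω
        · rw [indicator_of_mem h5, hφd0 t _ ht, mul_zero, neg_zero]
        · rw [indicator_of_notMem h5]
    rw [h2]
    refine (enorm_integral_le_lintegral_enorm _).trans ?_
    refine le_trans (setLIntegral_mono' (g := fun t => ‖ρ (x - t)‖ₑ * F t) hΩ fun t ht => ?_)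
      (setLIntegral_le_lintegral _ _)
    rw [enorm_mul, mul_comm]
    gcongr
    exact hF j t ht
  refine (enorm_clm_le_sum _).trans ((Finset.sum_le_sum fun j _ => hcomp j).trans ?_)
  simp

/-- The bumps have inner radius half the outer radius: this comparability lets Lebesgue
differentiation give almost everywhere convergence for a merely integrable `w`. All supports stay in
one ball of radius δ, so a single margin inside the domain suffices. -/
theorem exists_mollifiers {w : 𝔼 → ℝ} (hw : Integrable w) {δ : ℝ} (hδ : 0 < δ) :
    ∃ ρ : ℕ → 𝔼 → ℝ, (∀ k, ContDiff ℝ ∞ (ρ k)) ∧ (∀ k, tsupport (ρ k) ⊆ closedBall 0 δ) ∧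
      (∀ k, ∫⁻ x, ‖ρ k x‖ₑ = 1) ∧
      ∀ᵐ x : 𝔼, Tendsto (fun k => (w ⋆[lsmul ℝ ℝ, volume] ρ k) x) atTop (𝓝 (w x)) := by
  obtain ⟨b, hb, hb2⟩ : ∃ b : ℕ → ContDiffBump (0 : 𝔼), (∀ k, (b k).rOut = δ / ((k : ℝ) + 1)) ∧
      ∀ k, (b k).rOut ≤ 2 * (b k).rIn :=
    ⟨fun k => ⟨δ / (k + 1) / 2, δ / (k + 1), by positivity, half_lt_self (by positivity)⟩,
      fun k => rfl, fun k => (mul_div_cancel₀ _ two_ne_zero).ge⟩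
  have hrOut : Tendsto (fun k => (b k).rOut) atTop (𝓝 0) :=
    (((tendsto_one_div_add_atTop_nhds_zero_nat (𝕜 := ℝ)).const_mul δ).congr
      fun k => by simp [hb, div_eq_mul_inv]).trans (by simp)
  refine ⟨fun k => (b k).normed volume, fun k => (b k).contDiff_normed, fun k => ?_, fun k => ?_,
    ?_⟩
  · rw [(b k).tsupport_normed_eq, hb]
    exact closedBall_subset_closedBall (div_le_self hδ.le (by linarith [k.cast_nonneg (α := ℝ)]))
  · have h1 : ∀ x, ‖(b k).normed volume x‖ₑ = ENNReal.ofReal ((b k).normed volume x) := fun x => by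
      rw [Real.enorm_of_nonneg ((b k).nonneg_normed x)]
    simp_rw [h1]
    rw [← ofReal_integral_eq_lintegral_ofReal (b k).integrable_normed
      (Eventually.of_forall (b k).nonneg_normed), (b k).integral_normed, ENNReal.ofReal_one]
  · have h := ContDiffBump.ae_convolution_tendsto_right_of_locallyIntegrable (μ := volume)
      (φ := b) (l := atTop) (K := 2) hrOut (Eventually.of_forall hb2) hw.locallyIntegrable
    filter_upwards [h] with x hx
    refine hx.congr fun k => ?_
    rw [convolution_eq_swap]
    refine integral_congr_ae (Eventually.of_forall fun t => ?_)
    simp [mul_comm]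

/-- The Poincaré inequality on a convex set which is well inside the domain. -/
theorem lintegral_lintegral_enorm_sub_le_of_weak {Ω Q K : Set 𝔼} {u : 𝔼 → ℝ}
    {g : Fin n → 𝔼 → ℝ}
    {F : 𝔼 → ℝ≥0∞} (hF : ∀ j, ∀ x ∈ Ω, ‖g j x‖ₑ ≤ F x) (hFm : Measurable F)
    (hΩ : MeasurableSet Ω)
    (hweak : ∀ φ : 𝔼 → ℝ, ContDiff ℝ ∞ φ → HasCompactSupport φ → tsupport φ ⊆ Ω → ∀ j,
      ∫ x in Ω, u x * fderiv ℝ φ x (EuclideanSpace.single j 1) = - ∫ x in Ω, g j x * φ x)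
    (hQΩ : Q ⊆ Ω) (hQ : MeasurableSet Q) (hu : IntegrableOn u Q)
    (hK : Convex ℝ K) (hKm : MeasurableSet K) {δ : ℝ} (hδ : 0 < δ)
    (hKQ : ∀ x ∈ K, closedBall x δ ⊆ Q) {R : ℝ≥0∞} (hR : ∀ y ∈ K, ∀ z ∈ K, ‖z - y‖ₑ ≤ R) :
    ∫⁻ y in K, ∫⁻ z in K, ‖u y - u z‖ₑ ≤
      2 ^ n * R * volume K * (n * ∫⁻ x in Q, F x) := by
  have hui : Integrable (Q.indicator u) := (integrable_indicator_iff hQ).2 hu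
  obtain ⟨ρ, hρs, hts, hρ1, hlim⟩ := exists_mollifiers hui hδ
  set U : ℕ → 𝔼 → ℝ := fun k => Q.indicator u ⋆[lsmul ℝ ℝ, volume] ρ k with hUdef
  have hU : ∀ k, ContDiff ℝ 1 (U k) := fun k =>
    HasCompactSupport.contDiff_convolution_right (n := 1) _
      ((isCompact_closedBall 0 δ).of_isClosed_subset (isClosed_tsupport _) (hts k))
      hui.locallyIntegrable ((hρs k).of_le (by exact_mod_cast le_top))
  have hlimU : ∀ᵐ x : 𝔼, Tendsto (fun k => U k x) atTop (𝓝 (Q.indicator u x)) := hlim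
  clear_value U
  have hgrad : ∀ k, ∫⁻ x in K, ‖fderiv ℝ (U k) x‖ₑ ≤ n * ∫⁻ x in Q, F x := by
    intro k
    have hm : Measurable fun q : 𝔼 × 𝔼 => ‖ρ k (q.1 - q.2)‖ₑ * Q.indicator F q.2 := by
      refine Measurable.mul ?_ ((hFm.indicator hQ).comp measurable_snd)
      exact ((hρs k).continuous.comp (continuous_fst.sub continuous_snd)).enorm.measurable
    calc ∫⁻ x in K, ‖fderiv ℝ (U k) x‖ₑ
        ≤ ∫⁻ x in K, n * ∫⁻ t, ‖ρ k (x - t)‖ₑ * Q.indicator F t := by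
          refine setLIntegral_mono' hKm fun x hx => ?_
          rw [hUdef]
          refine (enorm_fderiv_convolution_le hF hΩ hweak hQΩ hui (hρs k) (hts k)
            (hKQ x hx)).trans ?_
          gcongr _ * ?_
          refine lintegral_mono fun t => ?_
          by_cases ht : t ∈ Q
          · simp only [indicator_of_mem ht, le_refl]
          · have : ρ k (x - t) = 0 := by
              refine image_eq_zero_of_notMem_tsupport fun h => ht (hKQ x hx ?_)
              replace h := hts k h
              rw [mem_closedBall, dist_zero_right] at h
              rwa [mem_closedBall, dist_comm, dist_eq_norm]
            rw [this]; simp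
      _ = n * ∫⁻ x in K, ∫⁻ t, ‖ρ k (x - t)‖ₑ * Q.indicator F t := by
          rw [lintegral_const_mul]
          exact hm.lintegral_prod_right'
      _ = n * ∫⁻ t, ∫⁻ x in K, ‖ρ k (x - t)‖ₑ * Q.indicator F t := by
          rw [lintegral_lintegral_swap]
          exact hm.aemeasurable
      _ ≤ n * ∫⁻ t, Q.indicator F t := by
          gcongr with t
          refine (setLIntegral_le_lintegral _ _).trans ?_
          rw [lintegral_mul_const _ (by
            exact ((hρs k).continuous.comp (continuous_id.sub continuous_const)).enorm.measurable),
            lintegral_sub_right_eq_self (fun x => ‖ρ k x‖ₑ) t, hρ1, one_mul]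
      _ = n * ∫⁻ x in Q, F x := by rw [lintegral_indicator hQ]
  have hbound : ∀ k, ∫⁻ y in K, ∫⁻ z in K, ‖U k y - U k z‖ₑ ≤
      2 ^ n * R * volume K * (n * ∫⁻ x in Q, F x) := by
    intro k
    have h := lintegral_lintegral_enorm_sub_le_of_contDiff volume (hU k) hK hKm hR
    rw [finrank_euclideanSpace_fin] at h
    exact h.trans (by gcongr; exact hgrad k)
  have hUm : ∀ k, Measurable fun q : 𝔼 × 𝔼 => ‖U k q.1 - U k q.2‖ₑ := fun k =>
    (((hU k).continuous.comp continuous_fst).sub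
      ((hU k).continuous.comp continuous_snd)).enorm.measurable
  have hKQ' : K ⊆ Q := fun x hx => hKQ x hx (mem_closedBall_self hδ.le)
  calc ∫⁻ y in K, ∫⁻ z in K, ‖u y - u z‖ₑ
      = ∫⁻ y in K, ∫⁻ z in K, liminf (fun k => ‖U k y - U k z‖ₑ) atTop := by
        refine setLIntegral_congr_fun_ae hKm ?_
        filter_upwards [hlimU] with y hy hyK
        refine setLIntegral_congr_fun_ae hKm ?_
        filter_upwards [hlimU] with z hz hzK
        rw [indicator_of_mem (hKQ' hyK)] at hy
        rw [indicator_of_mem (hKQ' hzK)] at hz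
        exact ((hy.sub hz).enorm.liminf_eq).symm
    -- Fatou's lemma, once in each variable.
    _ ≤ ∫⁻ y in K, liminf (fun k => ∫⁻ z in K, ‖U k y - U k z‖ₑ) atTop := by
        refine lintegral_mono fun y => lintegral_liminf_le fun k => ?_
        exact (hUm k).comp measurable_prodMk_left
    _ ≤ liminf (fun k => ∫⁻ y in K, ∫⁻ z in K, ‖U k y - U k z‖ₑ) atTop :=
        lintegral_liminf_le fun k => (hUm k).lintegral_prod_right'
    _ ≤ _ := liminf_le_of_frequently_le' (Frequently.of_forall hbound)

/-- A locally integrable function with a weak gradient satisfies the Poincaré inequality on all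
bounded open convex subsets of its domain. -/
theorem hasConvexPoincare_of_weak {Ω : Set 𝔼} {u : 𝔼 → ℝ} (hum : Measurable u)
    (hu : LocallyIntegrableOn u Ω)
    {g : Fin n → 𝔼 → ℝ}
    {F : 𝔼 → ℝ≥0∞} (hF : ∀ j, ∀ x ∈ Ω, ‖g j x‖ₑ ≤ F x) (hFm : Measurable F)
    (hΩ : MeasurableSet Ω)
    (hweak : ∀ φ : 𝔼 → ℝ, ContDiff ℝ ∞ φ → HasCompactSupport φ → tsupport φ ⊆ Ω → ∀ j,
      ∫ x in Ω, u x * fderiv ℝ φ x (EuclideanSpace.single j 1) = - ∫ x in Ω, g j x * φ x) :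
    HasConvexPoincare volume (2 ^ (n + 1) * n) Ω u F := by
  intro K x₀ R hKo hK hKΩ hKR
  -- Inner parallel sets of K: convex and compact for δ > 0, exhausting K as δ → 0. Mollifying at
  -- scale δ/2 on `S δ` only uses values on `S (δ / 2)`, where u is integrable although it need not
  -- be so on K.
  let S : ℝ → Set 𝔼 := fun δ => ⋂ y ∈ Kᶜ, {x | δ ≤ dist x y}
  have hSmem : ∀ δ x, x ∈ S δ ↔ ∀ y ∈ Kᶜ, δ ≤ dist x y := fun δ x => by simp [S]
  have hSc : ∀ δ, IsClosed (S δ) := fun δ =>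
    isClosed_biInter fun y _ => isClosed_le continuous_const (continuous_id.dist continuous_const)
  have hSK : ∀ δ, 0 < δ → S δ ⊆ K := by
    intro δ hδ x hx
    by_contra hxK
    have := (hSmem δ x).1 hx x hxK
    rw [dist_self] at this
    linarith
  have hScomp : ∀ δ, 0 < δ → IsCompact (S δ) := fun δ hδ =>
    (isCompact_closedBall x₀ R).of_isClosed_subset (hSc δ) ((hSK δ hδ).trans hKR)
  have hSanti : ∀ δ δ', δ ≤ δ' → S δ' ⊆ S δ := fun δ δ' h x hx =>
    (hSmem _ _).2 fun y hy => h.trans ((hSmem _ _).1 hx y hy)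
  have hSconv : ∀ δ, Convex ℝ (S δ) := by
    intro δ x hx y hy a c ha hc hac
    rw [hSmem] at hx hy ⊢
    intro w hw
    by_contra! hlt
    apply hw
    -- The displacement v, shorter than δ, moves both x and y to points of K, so w would be a convex
    -- combination of points of K.
    set v := w - (a • x + c • y) with hv
    have hvn : ‖v‖ < δ := by rwa [hv, ← dist_eq_norm, dist_comm]
    have h1 : x + v ∈ K := by
      by_contra h
      have := hx _ h
      rw [dist_self_add_right] at this
      linarith
    have h2 : y + v ∈ K := by
      by_contra h
      have := hy _ h
      rw [dist_self_add_right] at this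
      linarith
    have h3 : w = a • (x + v) + c • (y + v) := by
      have h4 : a • (x + v) + c • (y + v) = a • x + c • y + (a + c) • v := by module
      rw [h4, hac, hv]
      module
    rw [h3]
    exact hK h1 h2 ha hc hac
  let d : ℕ → ℝ := fun k => 1 / ((k : ℝ) + 1)
  have hd : ∀ k, 0 < d k := fun k => by positivity
  have hdanti : Antitone d := fun i j hij => by
    simp only [d]
    gcongr
  have hunion : ⋃ k, S (d k) = K := by
    refine subset_antisymm (iUnion_subset fun k => hSK _ (hd k)) fun x hx => ?_
    obtain ⟨r, hr, hrK⟩ := Metric.isOpen_iff.1 hKo x hx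
    obtain ⟨k, hk⟩ := exists_nat_one_div_lt hr
    refine mem_iUnion.2 ⟨k, (hSmem _ _).2 fun y hy => ?_⟩
    by_contra! h
    exact hy (hrK (by rw [mem_ball, dist_comm]; exact h.trans hk))
  have hmeas : Measurable fun q : 𝔼 × 𝔼 => ‖u q.1 - u q.2‖ₑ :=
    ((hum.comp measurable_fst).sub (hum.comp measurable_snd)).enorm
  have hprod : ∀ A : Set 𝔼, ∫⁻ y in A, ∫⁻ z in A, ‖u y - u z‖ₑ =
      ∫⁻ q in A ×ˢ A, ‖u q.1 - u q.2‖ₑ := by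
    intro A
    rw [Measure.volume_eq_prod, ← Measure.prod_restrict, lintegral_prod _ hmeas.aemeasurable]
  have hprodU : K ×ˢ K = ⋃ k, S (d k) ×ˢ S (d k) := by
    rw [← hunion]
    apply subset_antisymm
    · rintro ⟨p, q⟩ ⟨hp, hq⟩
      obtain ⟨i, hi⟩ := mem_iUnion.1 hp
      obtain ⟨j, hj⟩ := mem_iUnion.1 hq
      refine mem_iUnion.2 ⟨max i j, ?_, ?_⟩
      · exact hSanti _ _ (hdanti (le_max_left i j)) hi
      · exact hSanti _ _ (hdanti (le_max_right i j)) hj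
    · exact iUnion_subset fun k => prod_mono (subset_iUnion (fun k => S (d k)) k)
        (subset_iUnion (fun k => S (d k)) k)
  have hdir : Directed (· ⊆ ·) fun k => S (d k) ×ˢ S (d k) :=
    Monotone.directed_le fun i j hij =>
      prod_mono (hSanti _ _ (hdanti hij)) (hSanti _ _ (hdanti hij))
  rw [hprod, hprodU, setLIntegral_iUnion_of_directed _ hdir]
  refine iSup_le fun k => ?_
  rw [← hprod]
  have hQ : S (d k / 2) ⊆ K := hSK _ (half_pos (hd k))
  have hint : IntegrableOn u (S (d k / 2)) :=
    hu.integrableOn_compact_subset (hQ.trans hKΩ) (hScomp _ (half_pos (hd k)))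
  have hkq : ∀ x ∈ S (d k), closedBall x (d k / 2) ⊆ S (d k / 2) := by
    intro x hx y hy
    rw [hSmem] at hx ⊢
    intro w hw
    have h1 := hx w hw
    have h2 := dist_triangle x y w
    rw [mem_closedBall, dist_comm] at hy
    linarith
  have hRb : ∀ y ∈ S (d k), ∀ z ∈ S (d k), ‖z - y‖ₑ ≤ ENNReal.ofReal (2 * R) := by
    intro y hy z hz
    rw [← ofReal_norm, ← dist_eq_norm]
    apply ENNReal.ofReal_le_ofReal
    have h1 := hKR (hSK _ (hd k) hy)
    have h2 := hKR (hSK _ (hd k) hz)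
    rw [mem_closedBall] at h1 h2
    linarith [dist_triangle_right z y x₀]
  refine (lintegral_lintegral_enorm_sub_le_of_weak hF hFm hΩ hweak (hQ.trans hKΩ)
    (hSc _).measurableSet hint (hSconv _) (hSc _).measurableSet (half_pos (hd k)) hkq hRb).trans ?_
  -- The extra factor 2 in `2 ^ (n + 1)` comes from bounding the diameter by twice the radius R.
  rw [ENNReal.ofReal_mul zero_le_two, ENNReal.ofReal_ofNat]
  calc 2 ^ n * (2 * ENNReal.ofReal R) * volume (S (d k)) * (n * ∫⁻ x in S (d k / 2), F x)
      ≤ 2 ^ n * (2 * ENNReal.ofReal R) * volume K * (n * ∫⁻ x in K, F x) := by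
        gcongr
        exact hSK _ (hd k)
    _ = _ := by ring

end Mollification

/-! ### Maximal function, weak type inequality and choice of the level -/

section Maximal

/-- The averages of `F` over all balls centred at `x` are at most `Λ`. -/
def MaximalLE {E : Type*} [PseudoMetricSpace E] [MeasurableSpace E] (ν : Measure E)
    (F : E → ℝ≥0∞) (Λ : ℝ≥0∞) (x : E) : Prop :=
  ∀ r : ℝ, 0 < r → ∫⁻ y in closedBall x r, F y ∂ν ≤ Λ * ν (closedBall x r)

section Doubling

variable {E : Type*} [NormedAddCommGroup E] [NormedSpace ℝ E] [FiniteDimensional ℝ E]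
  [MeasurableSpace E] [BorelSpace E] (μ : Measure E) [μ.IsAddHaarMeasure]

/-- Lebesgue measure restricted to a convex set is doubling. -/
theorem Convex.restrict_closedBall_mul_le {T : Set E} (hT : Convex ℝ T) {x : E} (hx : x ∈ T)
    {t : ℝ} (ht : 1 ≤ t) (r : ℝ) :
    μ.restrict T (closedBall x (t * r)) ≤
      ENNReal.ofReal (t ^ finrank ℝ E) * μ.restrict T (closedBall x r) := by
  have ht0 : 0 < t := by linarith
  rw [Measure.restrict_apply measurableSet_closedBall,
    Measure.restrict_apply measurableSet_closedBall]
  set A := closedBall x (t * r) ∩ T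
  -- Contracting towards x ∈ T by the factor 1/t keeps the convex set T invariant, and scales
  -- measure by t^(-d).
  have hsub : AffineMap.homothety x t⁻¹ '' A ⊆ closedBall x r ∩ T := by
    rintro _ ⟨y, ⟨hy, hyT⟩, rfl⟩
    have heq : AffineMap.homothety x t⁻¹ y = x + t⁻¹ • (y - x) := by
      rw [AffineMap.homothety_apply, vsub_eq_sub, vadd_eq_add, add_comm]
    rw [heq]
    refine ⟨?_, hT.add_smul_sub_mem hx hyT ⟨by positivity, inv_le_one_of_one_le₀ ht⟩⟩
    rw [mem_closedBall, dist_self_add_left, norm_smul, Real.norm_of_nonneg (by positivity),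
      ← dist_eq_norm, inv_mul_le_iff₀ ht0]
    exact hy
  have h := measure_mono (μ := μ) hsub
  rw [Measure.addHaar_image_homothety] at h
  calc μ A = ENNReal.ofReal (t ^ finrank ℝ E) *
        (ENNReal.ofReal |t⁻¹ ^ finrank ℝ E| * μ A) := by
        rw [← mul_assoc, ← ENNReal.ofReal_mul (by positivity), abs_of_nonneg (by positivity),
          inv_pow, mul_inv_cancel₀ (by positivity), ENNReal.ofReal_one, one_mul]
    _ ≤ _ := by gcongr

end Doubling

section WeakType

variable {E : Type*} [PseudoMetricSpace E] [SecondCountableTopology E]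
  [MeasurableSpace E] [BorelSpace E] {ν : Measure E}

/-- Vitali's covering lemma selects disjoint balls whose fivefold enlargements cover S. Doubling is
needed only at centres in S, which is what makes restricted measures admissible. The bound R on the
radii is what the covering lemma requires. -/
theorem mul_measure_le_of_bounded_radius {D Λ : ℝ≥0∞} {S : Set E} {F : E → ℝ≥0∞} {R : ℝ}
    (hD : ∀ x ∈ S, ∀ r > 0, ν (closedBall x (5 * r)) ≤ D * ν (closedBall x r))
    (hS : ∀ x ∈ S, ∃ r, 0 < r ∧ r ≤ R ∧ Λ * ν (closedBall x r) ≤ ∫⁻ y in closedBall x r, F y ∂ν) :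
    Λ * ν S ≤ D * ∫⁻ y, F y ∂ν := by
  choose! r hr0 hrR hr using hS
  obtain ⟨u, huS, hdisj, hcov⟩ := Vitali.exists_disjoint_subfamily_covering_enlargement_closedBall
    S id r R hrR 5 (by norm_num)
  have hcount : u.Countable := hdisj.countable_of_nonempty_interior fun x hx =>
    ⟨x, ball_subset_interior_closedBall (mem_ball_self (hr0 x (huS hx)))⟩
  have hsub : S ⊆ ⋃ x ∈ u, closedBall x (5 * r x) := by
    intro x hx
    obtain ⟨b, hb, hsub⟩ := hcov x hx
    exact mem_iUnion₂.2 ⟨b, hb, hsub (mem_closedBall_self (hr0 x hx).le)⟩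
  calc Λ * ν S ≤ Λ * ∑' x : u, ν (closedBall (x : E) (5 * r x)) := by
        gcongr
        exact (measure_mono hsub).trans (measure_biUnion_le ν hcount _)
    _ = ∑' x : u, Λ * ν (closedBall (x : E) (5 * r x)) := ENNReal.tsum_mul_left.symm
    _ ≤ ∑' x : u, D * ∫⁻ y in closedBall (x : E) (r x), F y ∂ν := by
        refine ENNReal.tsum_le_tsum fun x => ?_
        calc Λ * ν (closedBall (x : E) (5 * r x)) ≤ Λ * (D * ν (closedBall (x : E) (r x))) := by
              gcongr
              exact hD x (huS x.2) _ (hr0 x (huS x.2))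
          _ = D * (Λ * ν (closedBall (x : E) (r x))) := by ring
          _ ≤ _ := by
              gcongr
              exact hr x (huS x.2)
    _ = D * ∫⁻ y in ⋃ x ∈ u, closedBall x (r x), F y ∂ν := by
        rw [ENNReal.tsum_mul_left]
        congr 1
        exact (lintegral_biUnion hcount (fun _ _ => measurableSet_closedBall) hdisj F).symm
    _ ≤ D * ∫⁻ y, F y ∂ν := by
        gcongr
        exact Measure.restrict_le_self

/-- The weak type `(1, 1)` inequality for the centred maximal function. -/
theorem mul_measure_le_of_not_maximalLE {D Λ : ℝ≥0∞} {S : Set E} {F : E → ℝ≥0∞}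
    (hD : ∀ x ∈ S, ∀ r > 0, ν (closedBall x (5 * r)) ≤ D * ν (closedBall x r))
    (hS : ∀ x ∈ S, ¬ MaximalLE ν F Λ x) :
    Λ * ν S ≤ D * ∫⁻ y, F y ∂ν := by
  let V : ℕ → Set E := fun N =>
    {x ∈ S | ∃ r, 0 < r ∧ r ≤ (N : ℝ) ∧ Λ * ν (closedBall x r) ≤ ∫⁻ y in closedBall x r, F y ∂ν}
  have hV : S = ⋃ N, V N := by
    refine subset_antisymm (fun x hx => ?_) (iUnion_subset fun N => sep_subset _ _)
    have h := hS x hx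
    simp only [MaximalLE, not_forall, not_le] at h
    obtain ⟨r, hr, hlt⟩ := h
    obtain ⟨N, hN⟩ := exists_nat_ge r
    exact mem_iUnion.2 ⟨N, hx, r, hr, hN, hlt.le⟩
  have hmono : Monotone V := by
    rintro i j hij x ⟨hx, r, h0, hr, h⟩
    exact ⟨hx, r, h0, hr.trans (by exact_mod_cast hij), h⟩
  -- Continuity from below holds for increasing unions of arbitrary sets, so S need not be
  -- measurable.
  rw [hV, hmono.directed_le.measure_iUnion, ENNReal.mul_iSup]
  exact iSup_le fun N =>
    mul_measure_le_of_bounded_radius (R := N) (fun x hx => hD x hx.1) fun x hx => hx.2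

/-- The weak type inequality, in the form which only sees the large values of `F`. -/
theorem mul_measure_le_setLIntegral_of_not_maximalLE {D Λ : ℝ≥0∞} {S : Set E}
    {F : E → ℝ≥0∞} (hF : Measurable F)
    (hD : ∀ x ∈ S, ∀ r > 0, ν (closedBall x (5 * r)) ≤ D * ν (closedBall x r))
    (hS : ∀ x ∈ S, ¬ MaximalLE ν F (2 * Λ) x) :
    Λ * ν S ≤ D * ∫⁻ y in {y | Λ < F y}, F y ∂ν := by
  have hm : MeasurableSet {y | Λ < F y} := measurableSet_lt measurable_const hF
  rw [← lintegral_indicator hm]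
  -- Since F ≤ F·1_{F > Λ} + Λ, averages of the truncated function at most Λ force averages of F at
  -- most 2Λ.
  refine mul_measure_le_of_not_maximalLE hD fun x hx hgood => hS x hx fun r hr => ?_
  calc ∫⁻ y in closedBall x r, F y ∂ν
      ≤ ∫⁻ y in closedBall x r, ({y | Λ < F y}.indicator F y + Λ) ∂ν := by
        refine lintegral_mono fun y => ?_
        by_cases hy : Λ < F y
        · rw [indicator_of_mem (by exact hy)]; exact le_self_add (a := F y)
        · exact (not_lt.1 hy).trans (le_add_left le_rfl)
    _ = ∫⁻ y in closedBall x r, {y | Λ < F y}.indicator F y ∂ν + Λ * ν (closedBall x r) := by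
        rw [lintegral_add_right _ measurable_const, setLIntegral_const]
    _ ≤ Λ * ν (closedBall x r) + Λ * ν (closedBall x r) := by
        gcongr
        exact hgood r hr
    _ = 2 * Λ * ν (closedBall x r) := by ring

end WeakType

section Level

/-- The inner integral after Fubini in `exists_level`. It is dominated by ∫ s^(p-2) over (0, y/c],
which converges at 0 exactly because p > 1. -/
theorem setLIntegral_rpow_le {p : ℝ} (hp : 1 < p) {c : ℝ} (hc : 0 < c) (a A : ℝ) (ha : 0 < a)
    (y : ℝ≥0∞) :
    ∫⁻ s in Icc a A, {s : ℝ | ENNReal.ofReal (c * s) < y}.indicator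
      (fun s => ENNReal.ofReal (s ^ (p - 2))) s ≤
      ENNReal.ofReal (1 / (c ^ (p - 1) * (p - 1))) * y ^ (p - 1) := by
  have hcp : 0 < c ^ (p - 1) := Real.rpow_pos_of_pos hc _
  rcases eq_or_ne y ⊤ with rfl | hy
  · rw [ENNReal.top_rpow_of_pos (by linarith), ENNReal.mul_top]
    · exact le_top
    · rw [Ne, ENNReal.ofReal_eq_zero, not_le]
      have : 0 < p - 1 := by linarith
      positivity
  lift y to NNReal using hy
  set b : ℝ := y / c with hb
  have hb0 : 0 ≤ b := by positivity
  have hii : IntervalIntegrable (fun s : ℝ => s ^ (p - 2)) volume 0 b :=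
    intervalIntegral.intervalIntegrable_rpow' (by linarith)
  calc ∫⁻ s in Icc a A, {s : ℝ | ENNReal.ofReal (c * s) < y}.indicator
        (fun s => ENNReal.ofReal (s ^ (p - 2))) s
      ≤ ∫⁻ s in Icc a A, (Ioc 0 b).indicator (fun s => ENNReal.ofReal (s ^ (p - 2))) s := by
        refine setLIntegral_mono' measurableSet_Icc fun s hs => ?_
        by_cases h : ENNReal.ofReal (c * s) < y
        · have hs' : s ∈ Ioc 0 b := by
            refine ⟨ha.trans_le hs.1, ?_⟩
            rw [← ENNReal.ofReal_coe_nnreal] at h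
            rw [hb, le_div_iff₀' hc]
            exact (ENNReal.ofReal_lt_ofReal_iff_of_nonneg
              (mul_nonneg hc.le (ha.le.trans hs.1))).1 h |>.le
          rw [indicator_of_mem (by exact h), indicator_of_mem hs']
        · rw [indicator_of_notMem (by exact h)]
          exact zero_le
    _ ≤ ∫⁻ s in Ioc 0 b, ENNReal.ofReal (s ^ (p - 2)) := by
        refine (setLIntegral_le_lintegral _ _).trans ?_
        rw [lintegral_indicator measurableSet_Ioc]
    _ = ENNReal.ofReal (b ^ (p - 1) / (p - 1)) := by
        rw [← ofReal_integral_eq_lintegral_ofReal]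
        · rw [← intervalIntegral.integral_of_le hb0, integral_rpow (Or.inl (by linarith))]
          rw [show p - 2 + 1 = p - 1 by ring, Real.zero_rpow (by linarith), sub_zero]
        · exact (intervalIntegrable_iff_integrableOn_Ioc_of_le hb0).1 hii
        · filter_upwards [ae_restrict_mem measurableSet_Ioc] with s hs
          exact Real.rpow_nonneg hs.1.le _
    _ = ENNReal.ofReal (1 / (c ^ (p - 1) * (p - 1))) * y ^ (p - 1) := by
        rw [← ENNReal.coe_rpow_of_nonneg _ (by linarith), ← ENNReal.ofReal_coe_nnreal,
          ← ENNReal.ofReal_mul (by have : 0 < p - 1 := by linarith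
                                   positivity), NNReal.coe_rpow, hb,
          Real.div_rpow (by positivity) hc.le]
        congr 1
        field_simp

/-- Selection of a good level: if `φ` satisfies a weak type bound against `F ∈ Lᵖ`, then
`sᵖ φ s` is at most a multiple of `‖F‖ₚᵖ / log (A / a)` for some `s ∈ [a, A]`. -/
theorem exists_level {α : Type*} [MeasurableSpace α] {ν : Measure α} [SFinite ν]
    {F : α → ℝ≥0∞} (hF : Measurable F) {p : ℝ} (hp : 1 < p) {c D : ℝ} (hc : 0 < c) (hD : 0 ≤ D)
    {φ : ℝ → ℝ≥0∞}
    (hφ : ∀ s > 0, ENNReal.ofReal (c * s) * φ s ≤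
      ENNReal.ofReal D * ∫⁻ x in {x | ENNReal.ofReal (c * s) < F x}, F x ∂ν)
    (hJ : ∫⁻ x, F x ^ p ∂ν ≠ ⊤) {a A : ℝ} (ha : 0 < a) (haA : a < A) :
    ∃ s ∈ Icc a A, ENNReal.ofReal (s ^ p) * φ s ≤
      ENNReal.ofReal ((D / (c ^ p * (p - 1)) + 1) / Real.log (A / a)) * ∫⁻ x, F x ^ p ∂ν := by
  set J := ∫⁻ x, F x ^ p ∂ν with hJdef
  set C := D / (c ^ p * (p - 1)) with hC
  have hp1 : 0 < p - 1 := by linarith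
  have hC0 : 0 ≤ C := by positivity
  have hlog : 0 < Real.log (A / a) := Real.log_pos ((one_lt_div ha).2 haA)
  -- If every level fails, integrating the failure against ds/s cancels the logarithm and leaves (C
  -- + 1) J ≤ C J. No measurability of φ is needed: it is eliminated pointwise inside the integrand.
  by_contra! hcon
  have hm : Measurable fun q : ℝ × α =>
      {q : ℝ × α | ENNReal.ofReal (c * q.1) < F q.2}.indicator
        (fun q => ENNReal.ofReal (q.1 ^ (p - 2)) * F q.2) q := by
    refine Measurable.indicator (by fun_prop) (measurableSet_lt (by fun_prop) (by fun_prop))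
  have hlow : ENNReal.ofReal (C + 1) * J ≤
      ∫⁻ s in Icc a A, ENNReal.ofReal s⁻¹ * (ENNReal.ofReal ((C + 1) / Real.log (A / a)) * J) := by
    rw [lintegral_mul_const _ (by fun_prop), ← mul_assoc]
    gcongr
    rw [← ofReal_integral_eq_lintegral_ofReal]
    · rw [integral_Icc_eq_integral_Ioc, ← intervalIntegral.integral_of_le haA.le,
        integral_inv_of_pos ha (ha.trans haA), ← ENNReal.ofReal_mul hlog.le]
      apply ENNReal.ofReal_le_ofReal
      field_simp
      exact le_rfl
    · apply ContinuousOn.integrableOn_Icc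
      exact continuousOn_inv₀.mono fun s hs => (ha.trans_le hs.1).ne'
    · filter_upwards [ae_restrict_mem measurableSet_Icc] with s hs
      exact inv_nonneg.2 (ha.le.trans hs.1)
  have hup : ENNReal.ofReal (C + 1) * J ≤ ENNReal.ofReal C * J := by
    calc ENNReal.ofReal (C + 1) * J
        ≤ ∫⁻ s in Icc a A,
          ENNReal.ofReal s⁻¹ * (ENNReal.ofReal ((C + 1) / Real.log (A / a)) * J) := hlow
      _ ≤ ∫⁻ s in Icc a A, ENNReal.ofReal (D / c) * ∫⁻ x,
          {q : ℝ × α | ENNReal.ofReal (c * q.1) < F q.2}.indicator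
            (fun q => ENNReal.ofReal (q.1 ^ (p - 2)) * F q.2) (s, x) ∂ν := by
          refine setLIntegral_mono' measurableSet_Icc fun s hs => ?_
          have hs0 : 0 < s := ha.trans_le hs.1
          have h1 : ∫⁻ x, {q : ℝ × α | ENNReal.ofReal (c * q.1) < F q.2}.indicator
              (fun q => ENNReal.ofReal (q.1 ^ (p - 2)) * F q.2) (s, x) ∂ν =
              ENNReal.ofReal (s ^ (p - 2)) *
                ∫⁻ x in {x | ENNReal.ofReal (c * s) < F x}, F x ∂ν := by
            rw [← lintegral_const_mul _ hF,
              ← lintegral_indicator (measurableSet_lt measurable_const hF)]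
            rfl
          rw [h1]
          calc ENNReal.ofReal s⁻¹ * (ENNReal.ofReal ((C + 1) / Real.log (A / a)) * J)
              ≤ ENNReal.ofReal s⁻¹ * (ENNReal.ofReal (s ^ p) * φ s) := by
                gcongr _ * ?_
                exact (hcon s hs).le
            _ = ENNReal.ofReal (s ^ (p - 2) / c) * (ENNReal.ofReal (c * s) * φ s) := by
                rw [← mul_assoc, ← mul_assoc, ← ENNReal.ofReal_mul (by positivity),
                  ← ENNReal.ofReal_mul (by positivity)]
                congr 2
                rw [Real.rpow_sub hs0, Real.rpow_two]
                field_simp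
            _ ≤ ENNReal.ofReal (s ^ (p - 2) / c) * (ENNReal.ofReal D *
                ∫⁻ x in {x | ENNReal.ofReal (c * s) < F x}, F x ∂ν) := by
                gcongr _ * ?_
                exact hφ s hs0
            _ = _ := by
                rw [← mul_assoc, ← mul_assoc, ← ENNReal.ofReal_mul (by positivity),
                  ← ENNReal.ofReal_mul (by positivity)]
                congr 2
                field_simp
      _ = ENNReal.ofReal (D / c) * ∫⁻ x, (∫⁻ s in Icc a A,
          {q : ℝ × α | ENNReal.ofReal (c * q.1) < F q.2}.indicator
            (fun q => ENNReal.ofReal (q.1 ^ (p - 2)) * F q.2) (s, x)) ∂ν := by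
          rw [lintegral_const_mul _ hm.lintegral_prod_right', lintegral_lintegral_swap hm.aemeasurable]
      _ ≤ ENNReal.ofReal (D / c) * ∫⁻ x,
          ENNReal.ofReal (1 / (c ^ (p - 1) * (p - 1))) * F x ^ p ∂ν := by
          gcongr _ * ?_
          refine lintegral_mono fun x => ?_
          have h2 : ∀ s : ℝ, {q : ℝ × α | ENNReal.ofReal (c * q.1) < F q.2}.indicator
              (fun q => ENNReal.ofReal (q.1 ^ (p - 2)) * F q.2) (s, x) =
              F x * {s : ℝ | ENNReal.ofReal (c * s) < F x}.indicator
                (fun s => ENNReal.ofReal (s ^ (p - 2))) s := by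
            intro s
            by_cases h : ENNReal.ofReal (c * s) < F x
            · rw [indicator_of_mem (by exact h), indicator_of_mem (by exact h), mul_comm]
            · rw [indicator_of_notMem (by exact h), indicator_of_notMem (by exact h), mul_zero]
          simp_rw [h2]
          rw [lintegral_const_mul _ (Measurable.indicator (by fun_prop)
            (measurableSet_lt (by fun_prop) measurable_const))]
          calc _ ≤ F x * (ENNReal.ofReal (1 / (c ^ (p - 1) * (p - 1))) * F x ^ (p - 1)) := by
                gcongr
                exact setLIntegral_rpow_le hp hc a A ha _
            _ = ENNReal.ofReal (1 / (c ^ (p - 1) * (p - 1))) * (F x ^ (1 : ℝ) * F x ^ (p - 1)) := by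
                rw [ENNReal.rpow_one]; ring
            _ = _ := by
                rw [← ENNReal.rpow_add_of_nonneg _ _ zero_le_one hp1.le]
                congr 2; ring
      _ = ENNReal.ofReal C * J := by
          rw [lintegral_const_mul _ (hF.pow_const p), ← mul_assoc,
            ← ENNReal.ofReal_mul (by positivity)]
          congr 2
          rw [hC, Real.rpow_sub hc, Real.rpow_one]
          field_simp
  -- The summand 1 in the constant leaves only J = 0. Then F vanishes almost everywhere, the weak
  -- type bound forces `φ a = 0`, and the strict failure at the level a is absurd.
  have hJ0 : J = 0 := by
    by_contra h
    rw [ENNReal.mul_le_mul_iff_left h hJ, ENNReal.ofReal_le_ofReal_iff hC0] at hup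
    linarith
  have hF0 : F =ᵐ[ν] 0 := by
    rw [hJdef, lintegral_eq_zero_iff (hF.pow_const p)] at hJ0
    filter_upwards [hJ0] with x hx
    rw [Pi.zero_apply, ENNReal.rpow_eq_zero_iff] at hx
    rcases hx with h | h
    · exact h.1
    · linarith [h.2]
  have h3 := hφ a ha
  rw [lintegral_congr_ae (ae_restrict_of_ae hF0)] at h3
  have h4 : φ a = 0 := by
    simpa [(mul_pos hc ha).not_ge] using h3
  have h5 := hcon a (left_mem_Icc.2 haA.le)
  rw [h4, mul_zero] at h5
  exact not_lt_zero h5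

end Level

end Maximal

/-! ### Mean oscillations and telescoping -/

section Oscillation

open Filter Topology

variable {E : Type*} [MeasurableSpace E] (μ : Measure E) (u : E → ℝ)

/-- The mean deviation of `u` from its value at `x` over the set `S`. -/
noncomputable def ptOsc (x : E) (S : Set E) : ℝ≥0∞ := (∫⁻ z in S, ‖u z - u x‖ₑ ∂μ) / μ S

/-- The mean difference between the values of `u` on `S` and those on `S'`. -/
noncomputable def meanOsc (S S' : Set E) : ℝ≥0∞ := (∫⁻ y in S, ptOsc μ u y S' ∂μ) / μ S

variable {μ u}

/-- The source of the triangle inequalities that pass through an intermediate set: a pointwise bound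
is averaged over the intermediate point. -/
theorem le_average_add_average {S : Set E} (h0 : μ S ≠ 0) (h1 : μ S ≠ ⊤)
    {f g : E → ℝ≥0∞} (hf : Measurable f) {c : ℝ≥0∞} (h : ∀ y, c ≤ f y + g y) :
    c ≤ (∫⁻ y in S, f y ∂μ) / μ S + (∫⁻ y in S, g y ∂μ) / μ S := by
  rw [← ENNReal.add_div, ← lintegral_add_left hf, ENNReal.le_div_iff_mul_le (Or.inl h0) (Or.inl h1),
    ← setLIntegral_const]
  exact lintegral_mono h

theorem average_add_const_le {S : Set E} (f : E → ℝ≥0∞) (k : ℝ≥0∞) :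
    (∫⁻ y in S, (f y + k) ∂μ) / μ S ≤ (∫⁻ y in S, f y ∂μ) / μ S + k := by
  rw [lintegral_add_right _ measurable_const, setLIntegral_const, ENNReal.add_div]
  gcongr
  exact ENNReal.div_le_of_le_mul le_rfl

theorem enorm_sub_le_enorm_sub_add (a b c : ℝ) : ‖a - c‖ₑ ≤ ‖a - b‖ₑ + ‖b - c‖ₑ := by
  rw [← sub_add_sub_cancel a b c]
  exact enorm_add_le _ _

theorem enorm_sub_le_ptOsc_add_ptOsc (hu : Measurable u) {S : Set E} (h0 : μ S ≠ 0) (h1 : μ S ≠ ⊤)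
    (x y : E) : ‖u x - u y‖ₑ ≤ ptOsc μ u x S + ptOsc μ u y S := by
  refine le_average_add_average h0 h1 (hu.sub measurable_const).enorm fun z => ?_
  rw [add_comm, Pi.sub_apply, ← enorm_neg (u x - u y), neg_sub]
  refine (enorm_sub_le_enorm_sub_add (u y) (u z) (u x)).trans ?_
  rw [add_comm, add_comm ‖u z - u y‖ₑ, ← enorm_neg (u z - u y), neg_sub, add_comm]

theorem ptOsc_le_enorm_add_ptOsc (x y : E) (S : Set E) :
    ptOsc μ u x S ≤ ‖u y - u x‖ₑ + ptOsc μ u y S := by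
  rw [add_comm]
  refine le_trans ?_ (average_add_const_le _ _)
  unfold ptOsc
  gcongr
  exact enorm_sub_le_enorm_sub_add _ _ _

theorem ptOsc_le_ptOsc_add_meanOsc (hu : Measurable u) {S' : Set E} (h0 : μ S' ≠ 0)
    (h1 : μ S' ≠ ⊤) (x : E) (S : Set E) : ptOsc μ u x S ≤ ptOsc μ u x S' + meanOsc μ u S' S :=
  le_average_add_average h0 h1 (hu.sub measurable_const).enorm
    fun y => ptOsc_le_enorm_add_ptOsc x y S

theorem meanOsc_triangle (hu : Measurable u) {S' : Set E} (h0 : μ S' ≠ 0)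
    (h1 : μ S' ≠ ⊤) (S S'' : Set E) :
    meanOsc μ u S S'' ≤ meanOsc μ u S S' + meanOsc μ u S' S'' := by
  refine le_trans ?_ (average_add_const_le _ _)
  rw [meanOsc]
  gcongr
  exact ptOsc_le_ptOsc_add_meanOsc hu h0 h1 _ _

theorem meanOsc_eq [SFinite μ] (hu : Measurable u) {S S' : Set E} (h : μ S ≠ ⊤) (h' : μ S' ≠ ⊤) :
    meanOsc μ u S S' = (∫⁻ y in S, ∫⁻ z in S', ‖u y - u z‖ₑ ∂μ ∂μ) / (μ S * μ S') := by
  have hm : Measurable fun y => ∫⁻ z in S', ‖u z - u y‖ₑ ∂μ := by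
    apply Measurable.lintegral_prod_right' (f := fun q : E × E => ‖u q.2 - u q.1‖ₑ)
    exact ((hu.comp measurable_snd).sub (hu.comp measurable_fst)).enorm
  have hsym : ∀ y z, ‖u y - u z‖ₑ = ‖u z - u y‖ₑ := fun y z => by rw [← enorm_neg, neg_sub]
  simp only [meanOsc, ptOsc, div_eq_mul_inv]
  rw [lintegral_mul_const _ hm, ENNReal.mul_inv (Or.inr h') (Or.inl h), mul_assoc,
    mul_comm (μ S')⁻¹]
  simp_rw [hsym]

theorem meanOsc_comm [SFinite μ] (hu : Measurable u) {S S' : Set E} (h : μ S ≠ ⊤) (h' : μ S' ≠ ⊤) :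
    meanOsc μ u S S' = meanOsc μ u S' S := by
  have hsym : ∀ y z, ‖u y - u z‖ₑ = ‖u z - u y‖ₑ := fun y z => by rw [← enorm_neg, neg_sub]
  rw [meanOsc_eq hu h h', meanOsc_eq hu h' h, mul_comm (μ S'), lintegral_lintegral_swap]
  · congr 1
    exact lintegral_congr fun y => lintegral_congr fun z => hsym _ _
  · exact ((hu.comp measurable_fst).sub (hu.comp measurable_snd)).enorm.aemeasurable

/-- Telescoping: the oscillation over `S 0` is at most that over `S k` plus the mean oscillations
between consecutive sets. The former tends to zero at a Lebesgue point and the latter sum to a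
geometric series. The sets need be neither nested nor centred at x, as the cone argument requires.
-/
theorem ptOsc_le_of_chain (hu : Measurable u) {x : E} {S : ℕ → Set E} (h0 : ∀ k, μ (S k) ≠ 0)
    (h1 : ∀ k, μ (S k) ≠ ⊤) (hlim : Tendsto (fun k => ptOsc μ u x (S k)) atTop (𝓝 0))
    {B q : ℝ≥0∞} (hB : ∀ k, meanOsc μ u (S (k + 1)) (S k) ≤ B * q ^ k) :
    ptOsc μ u x (S 0) ≤ B * (1 - q)⁻¹ := by
  have hind : ∀ k, ptOsc μ u x (S 0) ≤
      ptOsc μ u x (S k) + ∑ i ∈ Finset.range k, B * q ^ i := by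
    intro k
    induction k with
    | zero => simp
    | succ k ih =>
      refine ih.trans ?_
      rw [Finset.sum_range_succ, add_comm _ (B * q ^ k), ← add_assoc]
      gcongr
      exact (ptOsc_le_ptOsc_add_meanOsc hu (h0 (k + 1)) (h1 _) _ _).trans (by gcongr; exact hB k)
  have hle : ∀ k, ptOsc μ u x (S 0) ≤ ptOsc μ u x (S k) + B * (1 - q)⁻¹ := by
    intro k
    refine (hind k).trans ?_
    gcongr
    rw [← ENNReal.tsum_geometric, ← ENNReal.tsum_mul_left]
    exact ENNReal.sum_le_tsum _
  have := ge_of_tendsto' (hlim.add_const (B * (1 - q)⁻¹)) hle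
  rwa [zero_add] at this

end Oscillation

/-! ### Pointwise estimate on convex domains -/

section Chain

open Filter Topology

variable {E : Type*} [NormedAddCommGroup E] [NormedSpace ℝ E]
  [MeasurableSpace E] {μ : Measure E} {u : E → ℝ} {F : E → ℝ≥0∞} {C : ℝ≥0∞} {Ω T : Set E}

/-- The pointwise (Hajłasz) estimate: away from a null set, `u` is Lipschitz with constant `B * Λ`
on the set of the points of `Ω` where the maximal function of `F` is at most `Λ`. -/
def HasHajlaszBound (μ ν : Measure E) (B : ℝ≥0∞) (Ω : Set E) (u : E → ℝ) (F : E → ℝ≥0∞) : Prop :=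
  ∃ N : Set E, μ N = 0 ∧ ∀ x ∈ Ω \ N, ∀ y ∈ Ω \ N, ∀ Λ : ℝ≥0∞,
    MaximalLE ν F Λ x → MaximalLE ν F Λ y → ‖u x - u y‖ₑ ≤ B * Λ * ENNReal.ofReal (dist x y)

variable [FiniteDimensional ℝ E] [BorelSpace E] [μ.IsAddHaarMeasure]

omit [BorelSpace E] in
theorem meanOsc_le_of_subset (hum : Measurable u) (hP : HasConvexPoincare μ C Ω u F)
    {K S S' : Set E} {x : E} {R : ℝ}
    (hKo : IsOpen K) (hK : Convex ℝ K) (hKΩ : K ⊆ Ω) (hKR : K ⊆ closedBall x R)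
    (hS : S ⊆ K) (hS' : S' ⊆ K) :
    meanOsc μ u S S' ≤ (C * ENNReal.ofReal R * μ K * ∫⁻ y in K, F y ∂μ) / (μ S * μ S') := by
  have hfin : ∀ A ⊆ K, μ A ≠ ⊤ := fun A hA =>
    measure_ne_top_of_subset (hA.trans hKR) (isCompact_closedBall x R).measure_ne_top
  rw [meanOsc_eq hum (hfin S hS) (hfin S' hS')]
  gcongr
  refine le_trans ?_ (hP K x R hKo hK hKΩ hKR)
  calc ∫⁻ y in S, ∫⁻ z in S', ‖u y - u z‖ₑ ∂μ ∂μ ≤ ∫⁻ y in S, ∫⁻ z in K, ‖u y - u z‖ₑ ∂μ ∂μ := by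
        gcongr
    _ ≤ _ := lintegral_mono_set hS

/-- Poincaré on K bounds the oscillation by C R μ(K) ∫_K F / (μ(S) μ(S')). Comparability of S and S'
with the R-ball replaces μ(K)/μ(S) by D, and the maximal bound at x replaces ∫_K F / μ(S') by D Λ.
-/
theorem meanOsc_le_of_maximalLE (hum : Measurable u)
    (hP : HasConvexPoincare μ C Ω u F) {K S S' : Set E} {x : E}
    {R : ℝ} (hR : 0 < R) (hKo : IsOpen K) (hK : Convex ℝ K) (hKΩ : K ⊆ Ω) (hΩT : Ω ⊆ T)
    (hKR : K ⊆ closedBall x R) (hS : S ⊆ K) (hS' : S' ⊆ K) {Λ : ℝ≥0∞}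
    (hx : MaximalLE (μ.restrict T) F Λ x) {D : ℝ≥0∞}
    (hD : μ.restrict T (closedBall x R) ≤ D * μ S)
    (hD' : μ.restrict T (closedBall x R) ≤ D * μ S') :
    meanOsc μ u S S' ≤ C * ENNReal.ofReal R * D ^ 2 * Λ := by
  refine (meanOsc_le_of_subset hum hP hKo hK hKΩ hKR hS hS').trans ?_
  apply ENNReal.div_le_of_le_mul
  have h1 : μ K ≤ D * μ S := by
    refine le_trans ?_ hD
    rw [Measure.restrict_apply measurableSet_closedBall]
    exact measure_mono (subset_inter hKR (hKΩ.trans hΩT))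
  have h2 : ∫⁻ y in K, F y ∂μ ≤ Λ * (D * μ S') := by
    refine le_trans ?_ ((hx R hR).trans (by gcongr))
    rw [Measure.restrict_restrict measurableSet_closedBall]
    exact lintegral_mono_set (subset_inter hKR (hKΩ.trans hΩT))
  calc C * ENNReal.ofReal R * μ K * ∫⁻ y in K, F y ∂μ
      ≤ C * ENNReal.ofReal R * (D * μ S) * (Λ * (D * μ S')) := by gcongr
    _ = _ := by ring

/-- Lebesgue points, for balls of comparable size which need not be centred. -/
theorem ae_tendsto_ptOsc_closedBall (hΩ : IsOpen Ω) (hu : LocallyIntegrableOn u Ω μ) (K : ℝ) :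
    ∀ᵐ x ∂μ, x ∈ Ω → ∀ (w : ℕ → E) (δ : ℕ → ℝ), Tendsto δ atTop (𝓝[>] 0) →
      (∀ᶠ j in atTop, x ∈ closedBall (w j) (K * δ j)) →
      Tendsto (fun j => ptOsc μ u x (closedBall (w j) (δ j))) atTop (𝓝 0) := by
  obtain ⟨U, hUo, hΩU, hU⟩ := hu.exists_nat_integrableOn
  let v := IsUnifLocDoublingMeasure.vitaliFamily μ K
  -- Cutting off to countably many open pieces on which u is integrable yields one null set. The
  -- Vitali family with parameter K contains the eccentric balls needed later.
  have h : ∀ n, ∀ᵐ x ∂μ,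
      Tendsto (fun a => (∫⁻ y in a, ‖(U n ∩ Ω).indicator u y - (U n ∩ Ω).indicator u x‖ₑ ∂μ) / μ a)
        (v.filterAt x) (𝓝 0) := fun n =>
    v.ae_tendsto_lintegral_enorm_sub_div_of_integrable
      ((integrable_indicator_iff ((hUo n).inter hΩ).measurableSet).2 (hU n))
  filter_upwards [ae_all_iff.2 h] with x hx hxΩ w δ hδ hw
  obtain ⟨n, hn⟩ := mem_iUnion.1 (hΩU hxΩ)
  have hnhds : U n ∩ Ω ∈ 𝓝 x := ((hUo n).inter hΩ).mem_nhds ⟨hn, hxΩ⟩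
  have hcb := IsUnifLocDoublingMeasure.tendsto_closedBall_filterAt μ (K := K) w δ hδ hw
  refine ((hx n).comp hcb).congr' ?_
  filter_upwards [hcb.eventually (v.eventually_filterAt_subset_of_nhds hnhds)] with j hj
  rw [ptOsc, Function.comp_apply]
  congr 1
  refine setLIntegral_congr_fun measurableSet_closedBall fun y hy => ?_
  simp only [indicator_of_mem (hj hy), indicator_of_mem (show x ∈ U n ∩ Ω from ⟨hn, hxΩ⟩)]

/-- The pointwise estimate on convex domains. -/
theorem Convex.hasHajlaszBound (hΩ : IsOpen Ω) (hconv : Convex ℝ Ω) (hum : Measurable u)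
    (hu : LocallyIntegrableOn u Ω μ) (hP : HasConvexPoincare μ C Ω u F) :
    HasHajlaszBound μ (μ.restrict Ω) (11 * C * (ENNReal.ofReal (4 ^ finrank ℝ E)) ^ 2) Ω u F := by
  set D := ENNReal.ofReal (4 ^ finrank ℝ E) with hD
  have hdoub : ∀ x ∈ Ω, ∀ t : ℝ, 1 ≤ t → t ≤ 4 → ∀ r : ℝ,
      μ.restrict Ω (closedBall x (t * r)) ≤ D * μ (closedBall x r ∩ Ω) := by
    intro x hx t ht ht4 r
    refine (hconv.restrict_closedBall_mul_le μ hx ht r).trans ?_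
    rw [Measure.restrict_apply measurableSet_closedBall, hD]
    gcongr
  have hpos : ∀ x ∈ Ω, ∀ r : ℝ, 0 < r → μ (closedBall x r ∩ Ω) ≠ 0 := by
    intro x hx r hr
    have : (ball x r ∩ Ω).Nonempty := ⟨x, mem_ball_self hr, hx⟩
    exact (((isOpen_ball.inter hΩ).measure_pos μ this).trans_le
      (measure_mono (inter_subset_inter_left _ ball_subset_closedBall))).ne'
  have hfin : ∀ x r, μ (closedBall x r ∩ Ω) ≠ ⊤ := fun x r =>
    measure_ne_top_of_subset inter_subset_left (isCompact_closedBall x r).measure_ne_top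
  have hleb := ae_tendsto_ptOsc_closedBall (μ := μ) hΩ hu 1
  have hpt : ∀ x ∈ Ω, (∀ (w : ℕ → E) (δ : ℕ → ℝ), Tendsto δ atTop (𝓝[>] 0) →
      (∀ᶠ j in atTop, x ∈ closedBall (w j) (1 * δ j)) →
      Tendsto (fun j => ptOsc μ u x (closedBall (w j) (δ j))) atTop (𝓝 0)) →
      ∀ Λ, MaximalLE (μ.restrict Ω) F Λ x → ∀ r : ℝ, 0 < r →
      ptOsc μ u x (closedBall x r ∩ Ω) ≤ 4 * (C * ENNReal.ofReal r * D ^ 2 * Λ) := by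
    intro x hx hxl Λ hΛ r hr
    let S : ℕ → Set E := fun k => closedBall x (r * (1 / 2) ^ k) ∩ Ω
    have hrk : ∀ k : ℕ, 0 < r * (1 / 2) ^ k := fun k => by positivity
    have hrlim : Tendsto (fun k : ℕ => r * (1 / 2 : ℝ) ^ k) atTop (𝓝[>] 0) := by
      refine tendsto_nhdsWithin_iff.2 ⟨?_, Eventually.of_forall hrk⟩
      have := (tendsto_pow_atTop_nhds_zero_of_lt_one (r := (1 / 2 : ℝ)) (by norm_num)
        (by norm_num)).const_mul r
      rwa [mul_zero] at this
    have hlim : Tendsto (fun k => ptOsc μ u x (S k)) atTop (𝓝 0) := by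
      refine (hxl (fun _ => x) _ hrlim (Eventually.of_forall fun k => ?_)).congr' ?_
      · exact mem_closedBall_self (by rw [one_mul]; exact (hrk k).le)
      · obtain ⟨ε, hε, hεΩ⟩ := Metric.isOpen_iff.1 hΩ x hx
        have := (tendsto_nhdsWithin_iff.1 hrlim).1.eventually (gt_mem_nhds hε)
        filter_upwards [this] with k hk
        have : S k = closedBall x (r * (1 / 2) ^ k) :=
          inter_eq_left.2 ((closedBall_subset_ball hk).trans hεΩ)
        rw [this]
    -- The comparison ball has radius 2 r_k = 4 r_(k+1), hence D = 4^d. The ratio 1/2 makes the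
    -- geometric series contribute a factor 2.
    have hB : ∀ k, meanOsc μ u (S (k + 1)) (S k) ≤
        (2 * (C * ENNReal.ofReal r * D ^ 2 * Λ)) * (ENNReal.ofReal (1 / 2)) ^ k := by
      intro k
      have h4 : ∀ m, S m ⊆ ball x (2 * (r * (1 / 2) ^ m)) ∩ Ω := fun m =>
        inter_subset_inter_left _ (closedBall_subset_ball (by linarith [hrk m]))
      have hle : r * (1 / 2 : ℝ) ^ (k + 1) ≤ r * (1 / 2) ^ k := by
        rw [pow_succ]; nlinarith [hrk k]
      refine (meanOsc_le_of_maximalLE hum hP (x := x) (R := 2 * (r * (1 / 2) ^ k)) (T := Ω) (D := D)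
        (K := ball x (2 * (r * (1 / 2) ^ k)) ∩ Ω)
        (by linarith [hrk k]) (isOpen_ball.inter hΩ)
        ((convex_ball _ _).inter hconv) inter_subset_right subset_rfl
        (inter_subset_left.trans ball_subset_closedBall)
        ((h4 (k + 1)).trans (inter_subset_inter_left _ (ball_subset_ball (by linarith))))
        (h4 k) hΛ ?_ ?_).trans (le_of_eq ?_)
      · have := hdoub x hx 4 (by norm_num) le_rfl (r * (1 / 2) ^ (k + 1))
        rwa [show 4 * (r * (1 / 2) ^ (k + 1)) = 2 * (r * (1 / 2 : ℝ) ^ k) by ring] at this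
      · exact hdoub x hx 2 (by norm_num) (by norm_num) _
      · rw [ENNReal.ofReal_mul zero_le_two, ENNReal.ofReal_mul hr.le,
          ENNReal.ofReal_pow (by norm_num), ENNReal.ofReal_ofNat]
        ring
    have h := ptOsc_le_of_chain (μ := μ) hum (x := x) (S := S) (fun k => hpos x hx _ (hrk k))
      (fun k => hfin x _) hlim hB
    have hS0 : S 0 = closedBall x r ∩ Ω := by simp [S]
    rw [hS0] at h
    refine h.trans (le_of_eq ?_)
    have h2 : (1 - ENNReal.ofReal (1 / 2))⁻¹ = 2 := by
      rw [one_div, ENNReal.ofReal_inv_of_pos two_pos, ENNReal.ofReal_ofNat, ENNReal.one_sub_inv_two,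
        inv_inv]
    rw [h2]
    ring
  refine ⟨_, hleb, fun x hx y hy Λ hΛx hΛy => ?_⟩
  rcases eq_or_ne x y with rfl | hxy
  · simp
  have hd : 0 < dist x y := dist_pos.2 hxy
  set r := dist x y with hr
  have hxl := not_not.1 hx.2 hx.1
  have hyl := not_not.1 hy.2 hy.1
  have h1 := hpt x hx.1 hxl Λ hΛx r hd
  have h2 := hpt y hy.1 hyl Λ hΛy r hd
  -- With r = |x - y|, the ball of radius 3r about x contains both r-balls and lies in the 4r-ball
  -- about y. In the final sum 11 = 4 + 3 + 4.
  have h3 : meanOsc μ u (closedBall x r ∩ Ω) (closedBall y r ∩ Ω) ≤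
      C * ENNReal.ofReal (3 * r) * D ^ 2 * Λ := by
    refine meanOsc_le_of_maximalLE hum hP (x := x) (R := 3 * r) (T := Ω) (D := D)
      (K := ball x (3 * r) ∩ Ω)
      (by linarith) (isOpen_ball.inter hΩ)
      ((convex_ball _ _).inter hconv) inter_subset_right subset_rfl
      (inter_subset_left.trans ball_subset_closedBall)
      (inter_subset_inter_left _ (closedBall_subset_ball (by linarith)))
      (inter_subset_inter_left _ fun z hz => ?_) hΛx
      (hdoub x hx.1 3 (by norm_num) (by norm_num) _) ?_
    · rw [mem_closedBall] at hz
      rw [mem_ball]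
      linarith [dist_triangle z y x, dist_comm x y]
    · refine le_trans (measure_mono fun z hz => ?_) (hdoub y hy.1 4 (by norm_num) le_rfl r)
      rw [mem_closedBall] at hz ⊢
      linarith [dist_triangle z x y]
  calc ‖u x - u y‖ₑ ≤ ptOsc μ u x (closedBall y r ∩ Ω) + ptOsc μ u y (closedBall y r ∩ Ω) :=
        enorm_sub_le_ptOsc_add_ptOsc hum (hpos y hy.1 r hd) (hfin y r) x y
    _ ≤ (ptOsc μ u x (closedBall x r ∩ Ω) +
          meanOsc μ u (closedBall x r ∩ Ω) (closedBall y r ∩ Ω)) +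
        ptOsc μ u y (closedBall y r ∩ Ω) := by
        gcongr
        exact ptOsc_le_ptOsc_add_meanOsc hum (hpos x hx.1 r hd) (hfin x r) x _
    _ ≤ (4 * (C * ENNReal.ofReal r * D ^ 2 * Λ) + C * ENNReal.ofReal (3 * r) * D ^ 2 * Λ) +
        4 * (C * ENNReal.ofReal r * D ^ 2 * Λ) := by gcongr
    _ = 11 * C * D ^ 2 * Λ * ENNReal.ofReal r := by
        rw [ENNReal.ofReal_mul zero_le_three, ENNReal.ofReal_ofNat]
        ring

end Chain

/-! ### Pointwise estimate on domains with interior cones -/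

section Cone

open Filter Topology

/-- Near `x₀`, the set `Ω` contains truncated cones of fixed size, aperture and axis with vertex at
each of its points. -/
def HasLocalCone {E : Type*} [NormedAddCommGroup E] [NormedSpace ℝ E] (Ω : Set E) (x₀ : E) : Prop :=
  ∃ (e : E) (κ r : ℝ), ‖e‖ ≤ 1 ∧ 0 < κ ∧ κ ≤ 1 ∧ 0 < r ∧
    ∀ x ∈ Ω ∩ ball x₀ r, ∀ s : ℝ, 0 < s → s ≤ r → ball (x + s • e) (κ * s) ⊆ Ω

variable {E : Type*} [NormedAddCommGroup E] [NormedSpace ℝ E] [FiniteDimensional ℝ E]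
  [MeasurableSpace E] [BorelSpace E] {μ : Measure E} [μ.IsAddHaarMeasure]
  {u : E → ℝ} {F : E → ℝ≥0∞} {C : ℝ≥0∞} {Ω : Set E}

theorem addHaar_closedBall_le_mul_ball (x c : E) {R ρ M : ℝ} (hR : 0 ≤ R) (hρ : 0 < ρ)
    (h : R ≤ M * ρ) :
    μ (closedBall x R) ≤ ENNReal.ofReal (M ^ finrank ℝ E) * μ (ball c ρ) := by
  have hM : 0 ≤ M := nonneg_of_mul_nonneg_left (hR.trans h) hρ
  rw [Measure.addHaar_closedBall μ x hR, Measure.addHaar_ball_of_pos μ c hρ, ← mul_assoc,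
    ← ENNReal.ofReal_mul (by positivity), ← mul_pow]
  gcongr

/-- Comparison of the values of `u` on two sets inside a ball contained in `Ω`. -/
theorem meanOsc_le_of_ball (hum : Measurable u) (hP : HasConvexPoincare μ C Ω u F)
    {c : E} {R₀ : ℝ} (hΩ : ball c R₀ ⊆ Ω) {S S' : Set E} (hS : S ⊆ ball c R₀)
    (hS' : S' ⊆ ball c R₀) {x : E} {R : ℝ} (hR : 0 < R) (hKR : ball c R₀ ⊆ closedBall x R)
    {Λ : ℝ≥0∞} (hx : MaximalLE μ F Λ x) {M α β : ℝ} (hα : 0 < α) (hβ : 0 < β)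
    (hRα : R ≤ M * α) (hRβ : R ≤ M * β) {a b : E} (haS : ball a α ⊆ S) (hbS : ball b β ⊆ S') :
    meanOsc μ u S S' ≤ C * ENNReal.ofReal R * ENNReal.ofReal (M ^ finrank ℝ E) ^ 2 * Λ := by
  refine meanOsc_le_of_maximalLE hum hP hR isOpen_ball (convex_ball c R₀) hΩ (subset_univ Ω) hKR
    hS hS' (by rwa [Measure.restrict_univ]) ?_ ?_
  · rw [Measure.restrict_univ]
    refine (addHaar_closedBall_le_mul_ball x a hR.le hα hRα).trans ?_
    gcongr
  · rw [Measure.restrict_univ]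
    refine (addHaar_closedBall_le_mul_ball x b hR.le hβ hRβ).trans ?_
    gcongr

/-- Telescoping along a cone. -/
theorem ptOsc_le_of_cone (hum : Measurable u) (hP : HasConvexPoincare μ C Ω u F)
    {e x : E} {κ r : ℝ} (he : ‖e‖ ≤ 1) (hκ : 0 < κ) (hκ1 : κ ≤ 1)
    (hcone : ∀ s : ℝ, 0 < s → s ≤ r → ball (x + s • e) (κ * s) ⊆ Ω)
    (hleb : ∀ (w : ℕ → E) (δ : ℕ → ℝ), Tendsto δ atTop (𝓝[>] 0) →
      (∀ᶠ j in atTop, x ∈ closedBall (w j) (2 / κ * δ j)) →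
      Tendsto (fun j => ptOsc μ u x (closedBall (w j) (δ j))) atTop (𝓝 0))
    {Λ : ℝ≥0∞} (hx : MaximalLE μ F Λ x) {s : ℝ} (hs : 0 < s) (hsr : s ≤ r) :
    ptOsc μ u x (closedBall (x + s • e) (κ * s / 2)) ≤
      C * ENNReal.ofReal (2 * s) * ENNReal.ofReal ((8 / κ) ^ finrank ℝ E) ^ 2 * Λ *
        (1 - ENNReal.ofReal (1 - κ / 4))⁻¹ := by
  -- Passing from height t to q t moves the centre by at most κt/4, so the next ball, of radius at
  -- most κt/2, stays inside the ball of radius κt provided by the cone.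
  set q : ℝ := 1 - κ / 4 with hq
  have hq0 : 0 < q := by linarith
  have hq1 : q < 1 := by linarith
  let t : ℕ → ℝ := fun k => s * q ^ k
  have ht : ∀ k, 0 < t k := fun k => by positivity
  have hts : ∀ k, t k ≤ s := fun k => mul_le_of_le_one_right hs.le (pow_le_one₀ hq0.le hq1.le)
  have htsucc : ∀ k, t (k + 1) = t k - κ / 4 * t k := fun k => by
    simp only [t, pow_succ, hq]; ring
  let S : ℕ → Set E := fun k => closedBall (x + t k • e) (κ * t k / 2)
  have hS0 : S 0 = closedBall (x + s • e) (κ * s / 2) := by simp [S, t]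
  rw [← hS0]
  have hne : ∀ c : ℝ, 0 ≤ c → ‖c • e‖ ≤ c := fun c hc => by
    rw [norm_smul, Real.norm_of_nonneg hc]
    exact mul_le_of_le_one_right hc he
  refine ptOsc_le_of_chain hum (S := S) (fun k => ?_) (fun k => (isCompact_closedBall _ _).measure_ne_top)
    ?_ fun k => ?_
  · exact (measure_closedBall_pos μ _ (by have := ht k; positivity)).ne'
  -- The balls are off-centre: x is within t = (2/κ)(κt/2) of the centre, which fixes the
  -- eccentricity 2/κ.
  · refine hleb _ _ (tendsto_nhdsWithin_iff.2 ⟨?_, Eventually.of_forall fun k => ?_⟩)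
      (Eventually.of_forall fun k => ?_)
    · have := (tendsto_pow_atTop_nhds_zero_of_lt_one hq0.le hq1).const_mul (κ * s / 2)
      rw [mul_zero] at this
      refine this.congr fun k => ?_
      simp only [t]; ring
    · have := ht k
      show 0 < κ * t k / 2
      positivity
    · rw [mem_closedBall, dist_self_add_right]
      refine (hne _ (ht k).le).trans (le_of_eq ?_)
      field_simp
  · have h1 := ht k
    have h2 := htsucc k
    have hκt : κ * t k ≤ t k := mul_le_of_le_one_left h1.le hκ1
    have hκt0 : 0 < κ * t k := by positivity
    have h4 : κ * t (k + 1) ≤ κ * t k := by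
      rw [h2, mul_sub]
      have : 0 ≤ κ * (κ / 4 * t k) := by positivity
      linarith
    have h5 : 3 / 4 * (κ * t k) ≤ κ * t (k + 1) := by
      rw [h2, mul_sub]
      have : κ * (κ / 4 * t k) ≤ 1 * (κ / 4 * t k) := by gcongr
      linarith
    refine (meanOsc_le_of_ball hum hP (hcone (t k) h1 ((hts k).trans hsr)) (x := x)
      (R := 2 * t k) (M := 8 / κ) (α := κ * t (k + 1) / 2) (β := κ * t k / 2)
      ?_ ?_ (by linarith) ?_ hx (by linarith) (by linarith) ?_ ?_ ball_subset_closedBall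
      ball_subset_closedBall).trans (le_of_eq ?_)
    · intro z hz
      rw [mem_closedBall] at hz
      rw [mem_ball]
      have h3 : dist (x + t (k + 1) • e) (x + t k • e) ≤ κ / 4 * t k := by
        rw [dist_add_left, dist_comm, dist_eq_norm, ← sub_smul]
        have : t k - t (k + 1) = κ / 4 * t k := by linarith
        rw [this]
        exact hne _ (by positivity)
      linarith [dist_triangle z (x + t (k + 1) • e) (x + t k • e)]
    · exact closedBall_subset_ball (by linarith)
    · intro z hz
      rw [mem_ball] at hz
      rw [mem_closedBall]
      have h3 : dist (x + t k • e) x ≤ t k := by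
        rw [dist_self_add_left]
        exact hne _ h1.le
      linarith [dist_triangle z (x + t k • e) x]
    · rw [div_mul_div_comm, le_div_iff₀ (by positivity)]
      linarith
    · rw [div_mul_div_comm, le_div_iff₀ (by positivity)]
      linarith
    · have : 2 * t k = 2 * s * q ^ k := by simp only [t]; ring
      rw [this, ENNReal.ofReal_mul (by positivity), ENNReal.ofReal_pow hq0.le]
      ring

/-- The pointwise estimate near a point at which `Ω` has the local cone property, together with a
comparison with a reference ball. -/
theorem HasLocalCone.exists_bound (hC : C ≠ ⊤) (hΩ : IsOpen Ω) {x₀ : E} (hx₀ : x₀ ∈ closure Ω)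
    (hcone : HasLocalCone Ω x₀) :
    ∃ (δ : ℝ) (c : E) (ρ : ℝ) (B : ℝ≥0∞), 0 < δ ∧ 0 < ρ ∧ ball c ρ ⊆ Ω ∧ B ≠ ⊤ ∧
      ∀ (u : E → ℝ) (F : E → ℝ≥0∞), Measurable u → LocallyIntegrableOn u Ω μ →
        HasConvexPoincare μ C Ω u F →
        ∃ N : Set E, μ N = 0 ∧ ∀ x ∈ Ω ∩ ball x₀ δ, x ∉ N → ∀ Λ, MaximalLE μ F Λ x →
          ptOsc μ u x (ball c ρ) ≤ B * Λ ∧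
          ∀ y ∈ Ω ∩ ball x₀ δ, y ∉ N → MaximalLE μ F Λ y →
            ‖u x - u y‖ₑ ≤ B * Λ * ENNReal.ofReal (dist x y) := by
  obtain ⟨e, κ, r, he, hκ, hκ1, hr, hcone⟩ := hcone
  set W := ENNReal.ofReal ((8 / κ) ^ finrank ℝ E) ^ 2 with hW
  set Q := (1 - ENNReal.ofReal (1 - κ / 4))⁻¹ with hQ
  have hWtop : W ≠ ⊤ := ENNReal.pow_ne_top ENNReal.ofReal_ne_top
  have hQtop : Q ≠ ⊤ := by
    rw [hQ, Ne, ENNReal.inv_eq_top, tsub_eq_zero_iff_le, not_le, ENNReal.ofReal_lt_one]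
    linarith
  have hκr : κ * r ≤ r := mul_le_of_le_one_left hr.le hκ1
  have hκr0 : 0 < κ * r := by positivity
  have hne : ∀ c : ℝ, 0 ≤ c → ‖c • e‖ ≤ c := fun c hc => by
    rw [norm_smul, Real.norm_of_nonneg hc]
    exact mul_le_of_le_one_right hc he
  -- The reference ball about x₀ + r e lies in the top ball of the cone at every x close to x₀. As
  -- x₀ may be a boundary point, its inclusion in Ω is read off from a nearby point of Ω.
  have hsub : ∀ x, x ∈ ball x₀ (κ * r / 8) →
      ball (x₀ + r • e) (κ * r / 4) ⊆ ball (x + r • e) (κ * r) := by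
    intro x hx z hz
    rw [mem_ball] at hx hz ⊢
    have : dist (x₀ + r • e) (x + r • e) = dist x x₀ := by rw [dist_add_right, dist_comm]
    linarith [dist_triangle z (x₀ + r • e) (x + r • e)]
  have hball : ∀ x, x ∈ ball x₀ (κ * r / 8) → x ∈ ball x₀ r := fun x hx =>
    ball_subset_ball (by linarith) hx
  refine ⟨κ * r / 8, x₀ + r • e, κ * r / 4,
    2 * (C * W * (2 * Q + 1)) * (ENNReal.ofReal r + ENNReal.ofReal (4 / κ)),
    by positivity, by positivity, ?_, ?_, fun u F hum hu hP => ?_⟩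
  · obtain ⟨x, hxb, hxΩ⟩ := mem_closure_iff.1 hx₀ (ball x₀ (κ * r / 8)) isOpen_ball
      (mem_ball_self (by positivity))
    exact (hsub x hxb).trans (hcone x ⟨hxΩ, hball x hxb⟩ r hr le_rfl)
  · have h2 : (2 : ℝ≥0∞) ≠ ⊤ := ENNReal.ofNat_ne_top
    exact ENNReal.mul_ne_top (ENNReal.mul_ne_top h2 (ENNReal.mul_ne_top (ENNReal.mul_ne_top hC hWtop)
      (ENNReal.add_ne_top.2 ⟨ENNReal.mul_ne_top h2 hQtop, ENNReal.one_ne_top⟩)))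
      (ENNReal.add_ne_top.2 ⟨ENNReal.ofReal_ne_top, ENNReal.ofReal_ne_top⟩)
  have hpt : ∀ x ∈ Ω ∩ ball x₀ (κ * r / 8), (∀ (w : ℕ → E) (δ : ℕ → ℝ),
      Tendsto δ atTop (𝓝[>] 0) → (∀ᶠ j in atTop, x ∈ closedBall (w j) (2 / κ * δ j)) →
      Tendsto (fun j => ptOsc μ u x (closedBall (w j) (δ j))) atTop (𝓝 0)) →
      ∀ Λ, MaximalLE μ F Λ x → ∀ s, 0 < s → s ≤ r →
        ptOsc μ u x (closedBall (x + s • e) (κ * s / 2)) ≤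
          2 * (C * W * Q) * Λ * ENNReal.ofReal s := by
    intro x hx hxl Λ hΛ s hs hsr
    refine (ptOsc_le_of_cone hum hP he hκ hκ1 (hcone x ⟨hx.1, hball x hx.2⟩) hxl hΛ hs hsr).trans
      (le_of_eq ?_)
    rw [ENNReal.ofReal_mul zero_le_two, ENNReal.ofReal_ofNat]
    ring
  have hpos : ∀ c : E, ∀ s : ℝ, 0 < s → μ (closedBall c (κ * s / 2)) ≠ 0 := fun c s hs =>
    (measure_closedBall_pos μ c (by positivity)).ne'
  have hfin : ∀ c : E, ∀ s : ℝ, μ (closedBall c s) ≠ ⊤ := fun c s =>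
    (isCompact_closedBall _ _).measure_ne_top
  refine ⟨_, ae_tendsto_ptOsc_closedBall hΩ hu (2 / κ), fun x hx hxN Λ hΛx =>
    ⟨?_, fun y hy hyN hΛy => ?_⟩⟩
  · have hosc := meanOsc_le_of_ball hum hP
      (hcone x ⟨hx.1, hball x hx.2⟩ r hr le_rfl) (x := x) (R := 2 * r) (M := 8 / κ)
      (S := closedBall (x + r • e) (κ * r / 2)) (S' := ball (x₀ + r • e) (κ * r / 4))
      (α := κ * r / 2) (β := κ * r / 4)
      (closedBall_subset_ball (by linarith)) (hsub x hx.2) (by linarith) (fun z hz => by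
        rw [mem_ball] at hz
        rw [mem_closedBall]
        have h3 : dist (x + r • e) x ≤ r := by
          rw [dist_self_add_left]
          exact hne _ hr.le
        linarith [dist_triangle z (x + r • e) x]) hΛx (by positivity) (by positivity)
      (by rw [div_mul_div_comm, le_div_iff₀ (by positivity)]; linarith)
      (by rw [div_mul_div_comm, le_div_iff₀ (by positivity)]; linarith)
      ball_subset_closedBall subset_rfl
    calc ptOsc μ u x (ball (x₀ + r • e) (κ * r / 4))
        ≤ _ := ptOsc_le_ptOsc_add_meanOsc hum (hpos (x + r • e) r hr) (hfin _ _) x _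
      _ ≤ 2 * (C * W * Q) * Λ * ENNReal.ofReal r +
          C * ENNReal.ofReal (2 * r) * W * Λ := by
          gcongr
          exact hpt x hx (not_not.1 hxN hx.1) Λ hΛx r hr le_rfl
      _ = (2 * (C * W * (Q + 1)) * ENNReal.ofReal r) * Λ := by
          rw [ENNReal.ofReal_mul zero_le_two, ENNReal.ofReal_ofNat]
          ring
      _ ≤ _ := by
          gcongr
          · exact le_mul_of_one_le_left' one_le_two
          · exact le_self_add
  · rcases eq_or_ne x y with rfl | hxy
    · simp
    have hd : 0 < dist x y := dist_pos.2 hxy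
    -- At this height the two cone axes are κs/4 apart, so the ball of radius κs/2 on the axis of y
    -- fits inside the ball of radius κs on the axis of x. The radius κr/8 around x₀ guarantees s ≤
    -- r.
    set s := 4 / κ * dist x y with hs
    have hκs : κ * s = 4 * dist x y := by rw [hs]; field_simp
    have hs0 : 0 < s := by positivity
    have hdlt : dist x y < κ * r / 4 := by
      have h1 := hx.2
      have h2 := hy.2
      rw [mem_ball] at h1 h2
      linarith [dist_triangle_right x y x₀]
    have hsr : s ≤ r := by
      have : κ * s ≤ κ * r := by linarith
      exact le_of_mul_le_mul_left this hκ
    have hκs1 : κ * s ≤ s := mul_le_of_le_one_left hs0.le hκ1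
    have hosc := meanOsc_le_of_ball hum hP
      (hcone x ⟨hx.1, hball x hx.2⟩ s hs0 hsr) (x := x) (R := 2 * s) (M := 8 / κ)
      (S := closedBall (x + s • e) (κ * s / 2)) (S' := closedBall (y + s • e) (κ * s / 2))
      (α := κ * s / 2) (β := κ * s / 2)
      (closedBall_subset_ball (by linarith)) (fun z hz => by
        rw [mem_closedBall] at hz
        rw [mem_ball]
        have : dist (y + s • e) (x + s • e) = dist x y := by rw [dist_add_right, dist_comm]
        linarith [dist_triangle z (y + s • e) (x + s • e)]) (by linarith) (fun z hz => by
        rw [mem_ball] at hz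
        rw [mem_closedBall]
        have h3 : dist (x + s • e) x ≤ s := by
          rw [dist_self_add_left]
          exact hne _ hs0.le
        linarith [dist_triangle z (x + s • e) x]) hΛx (by positivity) (by positivity)
      (by rw [div_mul_div_comm, le_div_iff₀ (by positivity)]; linarith)
      (by rw [div_mul_div_comm, le_div_iff₀ (by positivity)]; linarith)
      ball_subset_closedBall ball_subset_closedBall
    calc ‖u x - u y‖ₑ
        ≤ ptOsc μ u x (closedBall (y + s • e) (κ * s / 2)) +
          ptOsc μ u y (closedBall (y + s • e) (κ * s / 2)) :=
          enorm_sub_le_ptOsc_add_ptOsc hum (hpos _ s hs0) (hfin _ _) x y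
      _ ≤ (ptOsc μ u x (closedBall (x + s • e) (κ * s / 2)) + _) +
          ptOsc μ u y (closedBall (y + s • e) (κ * s / 2)) := by
          gcongr
          exact ptOsc_le_ptOsc_add_meanOsc hum (hpos (x + s • e) s hs0) (hfin _ _) x _
      _ ≤ (2 * (C * W * Q) * Λ * ENNReal.ofReal s + C * ENNReal.ofReal (2 * s) * W * Λ) +
          2 * (C * W * Q) * Λ * ENNReal.ofReal s := by
          gcongr
          · exact hpt x hx (not_not.1 hxN hx.1) Λ hΛx s hs0 hsr
          · exact hpt y hy (not_not.1 hyN hy.1) Λ hΛy s hs0 hsr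
      _ = 2 * (C * W * (2 * Q + 1)) * ENNReal.ofReal (4 / κ) * Λ *
          ENNReal.ofReal (dist x y) := by
          rw [ENNReal.ofReal_mul zero_le_two, ENNReal.ofReal_ofNat, hs,
            ENNReal.ofReal_mul (by positivity)]
          ring
      _ ≤ _ := by
          gcongr
          exact le_add_self

omit [BorelSpace E] in
/-- In a connected open set, the values of `u` on two fixed balls are comparable. -/
theorem exists_meanOsc_ball_le (hC : C ≠ ⊤) (hΩ : IsOpen Ω) (hconn : IsPreconnected Ω)
    {p q : E} (hp : p ∈ Ω) (hq : q ∈ Ω) :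
    ∀ ρ ρ' : ℝ, 0 < ρ → 0 < ρ' → ball p ρ ⊆ Ω → ball q ρ' ⊆ Ω →
      ∃ B : ℝ≥0∞, B ≠ ⊤ ∧ ∀ (u : E → ℝ) (F : E → ℝ≥0∞), Measurable u →
        HasConvexPoincare μ C Ω u F →
        meanOsc μ u (ball p ρ) (ball q ρ') ≤ B * ∫⁻ x in Ω, F x ∂μ := by
  have hpos : ∀ (c : E) (r : ℝ), 0 < r → μ (ball c r) ≠ 0 := fun c r hr =>
    (measure_ball_pos μ c hr).ne'
  have hfin : ∀ (c : E) (r : ℝ), μ (ball c r) ≠ ⊤ := fun c r => measure_ball_lt_top.ne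
  have hlink : ∀ (c a b : E) (R α β : ℝ), 0 < α → 0 < β → ball c R ⊆ Ω → ball a α ⊆ ball c R →
      ball b β ⊆ ball c R → ∃ B : ℝ≥0∞, B ≠ ⊤ ∧ ∀ (u : E → ℝ) (F : E → ℝ≥0∞), Measurable u →
        HasConvexPoincare μ C Ω u F →
        meanOsc μ u (ball a α) (ball b β) ≤ B * ∫⁻ x in Ω, F x ∂μ := by
    intro c a b R α β hα hβ hΩR ha hb
    refine ⟨C * ENNReal.ofReal R * μ (ball c R) / (μ (ball a α) * μ (ball b β)), ?_,
      fun u F hum hP => ?_⟩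
    · exact ENNReal.div_ne_top (ENNReal.mul_ne_top (ENNReal.mul_ne_top hC ENNReal.ofReal_ne_top)
        (hfin _ _)) (mul_ne_zero (hpos a α hα) (hpos b β hβ))
    · refine (meanOsc_le_of_subset hum hP isOpen_ball (convex_ball c R) hΩR
        ball_subset_closedBall ha hb).trans ?_
      rw [ENNReal.mul_div_right_comm]
      gcongr
  -- The relation quantifies over all radii so that it is transitive. Nearby centres are linked by
  -- first shrinking both balls into one common ball in Ω.
  refine hconn.induction₂ (fun p q => ∀ ρ ρ' : ℝ, 0 < ρ → 0 < ρ' → ball p ρ ⊆ Ω → ball q ρ' ⊆ Ω →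
      ∃ B : ℝ≥0∞, B ≠ ⊤ ∧ ∀ (u : E → ℝ) (F : E → ℝ≥0∞), Measurable u →
        HasConvexPoincare μ C Ω u F →
        meanOsc μ u (ball p ρ) (ball q ρ') ≤ B * ∫⁻ x in Ω, F x ∂μ) ?_ ?_ ?_ hp hq
  · intro p hp
    obtain ⟨ε, hε, hεΩ⟩ := Metric.isOpen_iff.1 hΩ p hp
    filter_upwards [mem_nhdsWithin_of_mem_nhds (ball_mem_nhds p hε)] with q hq ρ ρ' hρ hρ' h h'
    rw [mem_ball] at hq
    set τ := min ρ ε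
    set τ' := min ρ' (ε - dist q p)
    have hτ : 0 < τ := lt_min hρ hε
    have hτ' : 0 < τ' := lt_min hρ' (by linarith)
    obtain ⟨B₁, hB₁, h₁⟩ := hlink p p p ρ ρ τ hρ hτ h subset_rfl
      (ball_subset_ball (min_le_left _ _))
    obtain ⟨B₂, hB₂, h₂⟩ := hlink p p q ε τ τ' hτ hτ' hεΩ (ball_subset_ball (min_le_right _ _))
      (ball_subset_ball' (by linarith [min_le_right ρ' (ε - dist q p)]))
    obtain ⟨B₃, hB₃, h₃⟩ := hlink q q q ρ' τ' ρ' hτ' hρ' h' (ball_subset_ball (min_le_left _ _))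
      subset_rfl
    refine ⟨B₁ + B₂ + B₃, by simp [hB₁, hB₂, hB₃], fun u F hum hP => ?_⟩
    calc meanOsc μ u (ball p ρ) (ball q ρ')
        ≤ meanOsc μ u (ball p ρ) (ball q τ') + meanOsc μ u (ball q τ') (ball q ρ') :=
          meanOsc_triangle hum (hpos _ _ hτ') (hfin _ _) _ _
      _ ≤ (meanOsc μ u (ball p ρ) (ball p τ) + meanOsc μ u (ball p τ) (ball q τ')) +
          meanOsc μ u (ball q τ') (ball q ρ') := by
          gcongr
          exact meanOsc_triangle hum (hpos _ _ hτ) (hfin _ _) _ _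
      _ ≤ (B₁ * ∫⁻ x in Ω, F x ∂μ + B₂ * ∫⁻ x in Ω, F x ∂μ) + B₃ * ∫⁻ x in Ω, F x ∂μ := by
          gcongr
          · exact h₁ u F hum hP
          · exact h₂ u F hum hP
          · exact h₃ u F hum hP
      _ = _ := by ring
  · intro p q z hp hq hz hpq hqz ρ ρ' hρ hρ' h h'
    obtain ⟨ε, hε, hεΩ⟩ := Metric.isOpen_iff.1 hΩ q hq
    obtain ⟨B₁, hB₁, h₁⟩ := hpq ρ ε hρ hε h hεΩ
    obtain ⟨B₂, hB₂, h₂⟩ := hqz ε ρ' hε hρ' hεΩ h'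
    refine ⟨B₁ + B₂, by simp [hB₁, hB₂], fun u F hum hP => ?_⟩
    refine (meanOsc_triangle hum (hpos q _ hε) (hfin _ _) _ _).trans ?_
    rw [add_mul]
    exact add_le_add (h₁ u F hum hP) (h₂ u F hum hP)
  · intro p q hp hq hpq ρ ρ' hρ hρ' h h'
    obtain ⟨B, hB, hle⟩ := hpq ρ' ρ hρ' hρ h' h
    refine ⟨B, hB, fun u F hum hP => ?_⟩
    rw [meanOsc_comm hum (hfin _ _) (hfin _ _)]
    exact hle u F hum hP

/-- The pointwise estimate on bounded connected open sets with the cone property. -/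
theorem exists_hasHajlaszBound_of_localCone (hC : C ≠ ⊤) (hΩ : IsOpen Ω)
    (hconn : IsPreconnected Ω) (hbdd : Bornology.IsBounded Ω)
    (hcone : ∀ x ∈ closure Ω, HasLocalCone Ω x) :
    ∃ B : ℝ≥0∞, B ≠ ⊤ ∧ ∀ (u : E → ℝ) (F : E → ℝ≥0∞), Measurable u → LocallyIntegrableOn u Ω μ →
      HasConvexPoincare μ C Ω u F → HasHajlaszBound μ μ B Ω u F := by
  have hloc : ∀ x : closure Ω, _ := fun x =>
    (hcone x x.2).exists_bound (μ := μ) hC hΩ x.2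
  choose δ c ρ B hδ hρ hcρ hB hest using hloc
  have hcomp : IsCompact (closure Ω) := hbdd.isCompact_closure
  obtain ⟨t, ht⟩ := hcomp.elim_finite_subcover (fun x : closure Ω => ball (x : E) (δ x))
    (fun _ => isOpen_ball) fun x hx => mem_iUnion.2 ⟨⟨x, hx⟩, mem_ball_self (hδ _)⟩
  -- Pairs closer than the Lebesgue number η lie in a single ball of the finite cover and use the
  -- local estimate; other pairs are compared through reference balls, and |x - y|/η ≥ 1 restores
  -- the factor of distance.
  obtain ⟨η, hη, hleb⟩ := lebesgue_number_lemma_of_metric hcomp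
    (c := fun i : t => ball ((i : closure Ω) : E) (δ i)) (fun _ => isOpen_ball)
    (fun x hx => by
      obtain ⟨i, hi, hxi⟩ := mem_iUnion₂.1 (ht hx)
      exact mem_iUnion.2 ⟨⟨i, hi⟩, hxi⟩)
  have hpair : ∀ i j : closure Ω, _ := fun i j =>
    exists_meanOsc_ball_le (μ := μ) hC hΩ hconn (hcρ i (mem_ball_self (hρ i)))
      (hcρ j (mem_ball_self (hρ j))) (ρ i) (ρ j) (hρ i) (hρ j) (hcρ i) (hcρ j)
  choose P hP hosc using hpair
  obtain ⟨R, hR, hdiam⟩ : ∃ R : ℝ, 0 < R ∧ ∀ x ∈ Ω, Ω ⊆ closedBall x R := by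
    obtain ⟨R, hR⟩ := hbdd.subset_closedBall (0 : E)
    refine ⟨2 * |R| + 1, by positivity, fun x hx y hy => ?_⟩
    have h1 := hR hx
    have h2 := hR hy
    rw [mem_closedBall] at h1 h2 ⊢
    linarith [dist_triangle_right y x (0 : E), le_abs_self R]
  set V := μ (closedBall (0 : E) R) with hV
  have hVtop : V ≠ ⊤ := (isCompact_closedBall _ _).measure_ne_top
  set sB := ∑ i ∈ t, B i with hsB
  set sP := ∑ i ∈ t, ∑ j ∈ t, P i j with hsP
  have hsBtop : sB ≠ ⊤ := ENNReal.sum_ne_top.2 fun i _ => hB i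
  have hsPtop : sP ≠ ⊤ := ENNReal.sum_ne_top.2 fun i _ => ENNReal.sum_ne_top.2 fun j _ => hP i j
  have hηinv : (ENNReal.ofReal η)⁻¹ ≠ ⊤ := by simpa using hη
  refine ⟨sB + (2 * sB + sP * V) * (ENNReal.ofReal η)⁻¹, ?_, fun u F hum hu hPu => ?_⟩
  · refine ENNReal.add_ne_top.2 ⟨hsBtop, ENNReal.mul_ne_top (ENNReal.add_ne_top.2
      ⟨ENNReal.mul_ne_top ENNReal.ofNat_ne_top hsBtop, ENNReal.mul_ne_top hsPtop hVtop⟩) hηinv⟩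
  choose N hN hNest using fun i => hest i u F hum hu hPu
  have hBle : ∀ i ∈ t, B i ≤ sB := fun i hi =>
    Finset.single_le_sum (f := B) (fun _ _ => zero_le) hi
  have hPle : ∀ i ∈ t, ∀ j ∈ t, P i j ≤ sP := fun i hi j hj =>
    (Finset.single_le_sum (f := P i) (fun _ _ => zero_le) hj).trans
      (Finset.single_le_sum (f := fun i => ∑ j ∈ t, P i j) (fun _ _ => zero_le) hi)
  refine ⟨⋃ i ∈ t, N i, ?_, fun x hx y hy Λ hΛx hΛy => ?_⟩
  · exact (measure_biUnion_null_iff t.countable_toSet).2 fun i _ => hN i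
  have hxN : ∀ i ∈ t, x ∉ N i := fun i hi h => hx.2 (mem_iUnion₂.2 ⟨i, hi, h⟩)
  have hyN : ∀ i ∈ t, y ∉ N i := fun i hi h => hy.2 (mem_iUnion₂.2 ⟨i, hi, h⟩)
  rcases lt_or_ge (dist x y) η with hlt | hge
  · obtain ⟨⟨i, hi⟩, hsub⟩ := hleb x (subset_closure hx.1)
    have hxi : x ∈ ball (i : E) (δ i) := hsub (mem_ball_self hη)
    have hyi : y ∈ ball (i : E) (δ i) := hsub (by rwa [mem_ball, dist_comm])
    refine ((hNest i x ⟨hx.1, hxi⟩ (hxN i hi) Λ hΛx).2 y ⟨hy.1, hyi⟩ (hyN i hi) hΛy).trans ?_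
    gcongr
    exact (hBle i hi).trans le_self_add
  · obtain ⟨i, hi, hxi⟩ := mem_iUnion₂.1 (ht (subset_closure hx.1))
    obtain ⟨j, hj, hyj⟩ := mem_iUnion₂.1 (ht (subset_closure hy.1))
    have h1 := (hNest i x ⟨hx.1, hxi⟩ (hxN i hi) Λ hΛx).1
    have h2 := (hNest j y ⟨hy.1, hyj⟩ (hyN j hj) Λ hΛy).1
    -- The maximal bound at x, at a radius whose ball contains all of Ω, controls the total
    -- integral.
    have hint : ∫⁻ z in Ω, F z ∂μ ≤ Λ * V := by
      refine (lintegral_mono_set (hdiam x hx.1)).trans ((hΛx R hR).trans (le_of_eq ?_))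
      rw [hV, Measure.addHaar_closedBall_center μ x R]
    have hone : 1 ≤ (ENNReal.ofReal η)⁻¹ * ENNReal.ofReal (dist x y) := by
      rw [mul_comm, ← div_eq_mul_inv, ENNReal.le_div_iff_mul_le (Or.inl (by simpa using hη))
        (Or.inl ENNReal.ofReal_ne_top), one_mul]
      exact ENNReal.ofReal_le_ofReal hge
    calc ‖u x - u y‖ₑ ≤ ptOsc μ u x (ball (c j) (ρ j)) + ptOsc μ u y (ball (c j) (ρ j)) :=
          enorm_sub_le_ptOsc_add_ptOsc hum (measure_ball_pos μ _ (hρ j)).ne'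
            measure_ball_lt_top.ne x y
      _ ≤ (ptOsc μ u x (ball (c i) (ρ i)) +
            meanOsc μ u (ball (c i) (ρ i)) (ball (c j) (ρ j))) +
          ptOsc μ u y (ball (c j) (ρ j)) := by
          gcongr
          exact ptOsc_le_ptOsc_add_meanOsc hum (measure_ball_pos μ _ (hρ i)).ne'
            measure_ball_lt_top.ne x _
      _ ≤ (sB * Λ + sP * (Λ * V)) + sB * Λ := by
          gcongr
          · exact h1.trans (by gcongr; exact hBle i hi)
          · refine (hosc i j u F hum hPu).trans ?_
            gcongr
            exact hPle i hi j hj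
          · exact h2.trans (by gcongr; exact hBle j hj)
      _ = (2 * sB + sP * V) * Λ * 1 := by ring
      _ ≤ (2 * sB + sP * V) * Λ * ((ENNReal.ofReal η)⁻¹ * ENNReal.ofReal (dist x y)) := by
          gcongr
      _ = (2 * sB + sP * V) * (ENNReal.ofReal η)⁻¹ * Λ * ENNReal.ofReal (dist x y) := by ring
      _ ≤ _ := by
          gcongr
          exact le_add_self

end Cone

/-- Near a boundary point, moving up by s gains height s, while a perturbation w costs at most ‖w‖
in height and 2K‖w‖ in the graph function. The aperture κ with (2K + 1)κ = 1 makes the total loss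
less than s. At an interior point the cone degenerates to balls, with axis vector 0. -/
theorem IsBoundedLipschitzDomain.hasLocalCone {n : ℕ} {Ω : Set (EuclideanSpace ℝ (Fin n))}
    (h : IsBoundedLipschitzDomain Ω) {x₀ : EuclideanSpace ℝ (Fin n)} (hx₀ : x₀ ∈ closure Ω) :
    HasLocalCone Ω x₀ := by
  by_cases hx : x₀ ∈ Ω
  · obtain ⟨r, hr, hrΩ⟩ := Metric.isOpen_iff.1 h.isOpen x₀ hx
    refine ⟨0, 1, r / 2, by simp, one_pos, le_rfl, by positivity, fun x hx s hs hsr => ?_⟩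
    refine (ball_subset_ball' ?_).trans hrΩ
    have h1 := hx.2
    rw [mem_ball] at h1
    rw [smul_zero, add_zero]
    linarith
  · have hfr : x₀ ∈ frontier Ω := ⟨hx₀, by rwa [h.isOpen.interior_eq]⟩
    obtain ⟨e, γ, K, r, he, hγ, hr, hgraph⟩ := h.locally_graph x₀ hfr
    set κ : ℝ := 1 / (2 * K + 1) with hκ
    have hκ0 : 0 < κ := by positivity
    have hκ1 : κ ≤ 1 := by
      rw [hκ, div_le_one (by positivity)]
      have := K.coe_nonneg
      linarith
    have hκK : 2 * K * κ + κ = 1 := by rw [hκ]; field_simp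
    refine ⟨e, κ, r / 4, he.le, hκ0, hκ1, by positivity, fun x hx s hs hsr z hz => ?_⟩
    set w := z - (x + s • e) with hw
    have hz' : z = x + s • e + w := by rw [hw]; abel
    have hwn : ‖w‖ < κ * s := by rwa [hw, ← dist_eq_norm]
    have hxb := hx.2
    rw [mem_ball] at hxb
    have hκs : κ * s ≤ s := mul_le_of_le_one_left hs.le hκ1
    have hzr : z ∈ ball x₀ r := by
      rw [mem_ball]
      have h1 : dist z x ≤ s + ‖w‖ := by
        rw [dist_eq_norm, hz', add_assoc, add_sub_cancel_left]
        refine (norm_add_le _ _).trans ?_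
        rw [norm_smul, he, mul_one, Real.norm_of_nonneg hs.le]
      linarith [dist_triangle z x x₀]
    have hxr : x ∈ ball x₀ r := by rw [mem_ball]; linarith
    rw [hgraph z hzr]
    have hxg := (hgraph x hxr).1 hx.1
    have hee : inner ℝ e e = (1 : ℝ) := by rw [real_inner_self_eq_norm_sq, he]; norm_num
    have hinner : inner ℝ e z = inner ℝ e x + s + inner ℝ e w := by
      rw [hz', inner_add_right, inner_add_right, inner_smul_right, hee, mul_one]
    have hew : |inner ℝ e w| ≤ ‖w‖ := by
      have := abs_real_inner_le_norm e w
      rwa [he, one_mul] at this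
    have hlip : γ (z - inner ℝ e z • e) ≤ γ (x - inner ℝ e x • e) + K * (2 * ‖w‖) := by
      have h1 := hγ.dist_le_mul (z - inner ℝ e z • e) (x - inner ℝ e x • e)
      have h2 : dist (z - inner ℝ e z • e) (x - inner ℝ e x • e) ≤ 2 * ‖w‖ := by
        have h3 : z - inner ℝ e z • e - (x - inner ℝ e x • e) = w - inner ℝ e w • e := by
          rw [hinner, hz']
          module
        rw [dist_eq_norm, h3]
        refine (norm_sub_le _ _).trans ?_
        rw [norm_smul, he, mul_one, Real.norm_eq_abs]
        linarith
      rw [Real.dist_eq] at h1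
      have h4 := le_abs_self (γ (z - inner ℝ e z • e) - γ (x - inner ℝ e x • e))
      have h5 : (K : ℝ) * dist (z - inner ℝ e z • e) (x - inner ℝ e x • e) ≤ K * (2 * ‖w‖) := by
        gcongr
      linarith
    have h6 := (abs_le.1 hew).1
    have h7 : (K : ℝ) * (2 * ‖w‖) ≤ K * (2 * (κ * s)) := by gcongr
    have h8 : (K : ℝ) * (2 * (κ * s)) + κ * s = s := by
      calc (K : ℝ) * (2 * (κ * s)) + κ * s = (2 * K * κ + κ) * s := by ring
        _ = s := by rw [hκK, one_mul]
    linarith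

/-! ### Weak gradients of Lipschitz maps -/

section LipschitzWeakGradient

theorem EuclideanSpace.norm_le_sum {ι : Type*} [Fintype ι] (x : EuclideanSpace ℝ ι) :
    ‖x‖ ≤ ∑ i, ‖x i‖ := by
  rw [EuclideanSpace.norm_eq, Real.sqrt_le_left (Finset.sum_nonneg fun _ _ => norm_nonneg _)]
  exact Finset.sum_sq_le_sq_sum_of_nonneg fun _ _ => norm_nonneg _

variable {E : Type*} [NormedAddCommGroup E] [NormedSpace ℝ E] [FiniteDimensional ℝ E]
  [MeasurableSpace E] [BorelSpace E] {μ : Measure E} [μ.IsAddHaarMeasure]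

/-- Integration by parts for a Lipschitz function against a test function. -/
theorem LipschitzWith.setIntegral_mul_fderiv {w : E → ℝ} {K : NNReal} (hw : LipschitzWith K w)
    {Ω : Set E} {φ : E → ℝ} (hφ : ContDiff ℝ ∞ φ) (hφc : HasCompactSupport φ)
    (hφΩ : tsupport φ ⊆ Ω) (e : E) :
    ∫ x in Ω, w x * fderiv ℝ φ x e ∂μ = -∫ x in Ω, fderiv ℝ w x e * φ x ∂μ := by
  obtain ⟨D, hD⟩ := hφ.lipschitzWith_of_hasCompactSupport hφc (by simp)
  have hout : ∀ x, x ∉ Ω → φ x = 0 := fun x hx =>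
    image_eq_zero_of_notMem_tsupport fun h => hx (hφΩ h)
  have hout' : ∀ x, x ∉ Ω → fderiv ℝ φ x = 0 := fun x hx =>
    image_eq_zero_of_notMem_tsupport fun h => hx (hφΩ (tsupport_fderiv_subset ℝ h))
  rw [setIntegral_eq_integral_of_forall_compl_eq_zero fun x hx => by simp [hout' x hx],
    setIntegral_eq_integral_of_forall_compl_eq_zero fun x hx => by simp [hout x hx]]
  have h := hw.integral_lineDeriv_mul_eq (μ := μ) hD hφc e
  -- By Rademacher's theorem, directional derivatives come from the Fréchet derivative almost
  -- everywhere.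
  have h1 : ∫ x, fderiv ℝ w x e * φ x ∂μ = ∫ x, lineDeriv ℝ w x e * φ x ∂μ := by
    refine integral_congr_ae ?_
    filter_upwards [hw.ae_differentiableAt (μ := μ)] with x hx
    rw [hx.lineDeriv_eq_fderiv]
  rw [h1, h, ← integral_neg]
  refine integral_congr_ae (Filter.Eventually.of_forall fun x => ?_)
  simp only
  rw [((hφ.differentiable (by simp)).differentiableAt).lineDeriv_eq_fderiv, map_neg]
  ring

/-- A map with `K`-Lipschitz components has a weak gradient of norm at most `n m K`. -/
theorem exists_hasWeakGradient_of_lipschitz {n m : ℕ} {w : Fin m → EuclideanSpace ℝ (Fin n) → ℝ}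
    {K : NNReal} (hw : ∀ i, LipschitzWith K (w i)) (Ω : Set (EuclideanSpace ℝ (Fin n))) :
    ∃ H : EuclideanSpace ℝ (Fin n) → EuclideanSpace ℝ (Fin m × Fin n),
      HasWeakGradient Ω (fun x => WithLp.toLp 2 fun i => w i x) H ∧
      ∀ x, ‖H x‖ ≤ m * n * K := by
  set H : EuclideanSpace ℝ (Fin n) → EuclideanSpace ℝ (Fin m × Fin n) :=
    fun x => WithLp.toLp 2 fun q => fderiv ℝ (w q.1) x (EuclideanSpace.single q.2 1) with hH
  have hbound : ∀ x, ‖H x‖ ≤ m * n * K := by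
    intro x
    calc ‖H x‖ ≤ ∑ q : Fin m × Fin n, ‖H x q‖ := EuclideanSpace.norm_le_sum _
      _ ≤ ∑ _q : Fin m × Fin n, (K : ℝ) := by
        refine Finset.sum_le_sum fun q _ => ?_
        refine (ContinuousLinearMap.le_opNorm _ _).trans ?_
        rw [PiLp.norm_single, norm_one, mul_one]
        exact norm_fderiv_le_of_lipschitz ℝ (hw q.1)
      _ = m * n * K := by simp
  have hHm : Measurable H := by
    refine (WithLp.measurable_toLp 2 _).comp (measurable_pi_lambda _ fun q => ?_)
    exact measurable_fderiv_apply_const ℝ (w q.1) _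
  refine ⟨H, ⟨?_, ?_, fun φ hφ hφc hφΩ i j => ?_⟩, hbound⟩
  · have : Continuous fun x => (WithLp.toLp 2 fun i => w i x : EuclideanSpace ℝ (Fin m)) :=
      (PiLp.continuous_toLp 2 _).comp (continuous_pi fun i => (hw i).continuous)
    exact this.locallyIntegrable.locallyIntegrableOn Ω
  · refine LocallyIntegrable.locallyIntegrableOn ?_ Ω
    refine (locallyIntegrable_const ((m * n * K : ℝ))).mono hHm.aestronglyMeasurable
      (Filter.Eventually.of_forall fun x => ?_)
    exact (hbound x).trans (le_abs_self _)
  · exact (hw i).setIntegral_mul_fderiv hφ hφc hφΩ _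

end LipschitzWeakGradient

/-! ### Lipschitz truncation at a good level -/

section Truncation

open Filter Topology

variable {n m : ℕ}

local notation "𝔼" => EuclideanSpace ℝ (Fin n)

/-- The components of a map with a weak gradient satisfy the Poincaré inequality, after a
modification on a null set. -/
theorem HasWeakGradient.exists_measurable {Ω : Set 𝔼} (hΩ : MeasurableSet Ω)
    {v : 𝔼 → EuclideanSpace ℝ (Fin m)} {G : 𝔼 → EuclideanSpace ℝ (Fin m × Fin n)}
    (h : HasWeakGradient Ω v G) :
    ∃ (u : Fin m → 𝔼 → ℝ) (F : 𝔼 → ℝ≥0∞), Measurable F ∧ (∀ x ∉ Ω, F x = 0) ∧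
      (∀ᵐ x ∂(volume.restrict Ω), F x = ‖G x‖ₑ) ∧ (∀ i, ∀ᵐ x ∂(volume.restrict Ω), u i x = v x i) ∧
      ∀ i, Measurable (u i) ∧ LocallyIntegrableOn (u i) Ω ∧
        HasConvexPoincare volume (2 ^ (n + 1) * n) Ω (u i) F := by
  have hv := h.locallyIntegrableOn.aestronglyMeasurable
  have hG := h.locallyIntegrableOn_gradient.aestronglyMeasurable
  set v' := hv.mk v
  set G' := hG.mk G
  have hv'm : Measurable v' := hv.stronglyMeasurable_mk.measurable
  have hG'm : Measurable G' := hG.stronglyMeasurable_mk.measurable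
  have hvae : v =ᵐ[volume.restrict Ω] v' := hv.ae_eq_mk
  have hGae : G =ᵐ[volume.restrict Ω] G' := hG.ae_eq_mk
  have hFm : Measurable (Ω.indicator fun x => ‖G' x‖ₑ) := hG'm.enorm.indicator hΩ
  have hum : ∀ i, Measurable fun x => v' x i := fun i =>
    (measurable_pi_apply i).comp ((WithLp.measurable_ofLp 2 _).comp hv'm)
  have hu : ∀ i, LocallyIntegrableOn (fun x => v' x i) Ω := by
    intro i x hx
    obtain ⟨U, hU, hUi⟩ := h.locallyIntegrableOn x hx
    have hU' : U ∩ Ω ∈ 𝓝[Ω] x := inter_mem hU self_mem_nhdsWithin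
    refine ⟨U ∩ Ω, hU', ?_⟩
    refine Integrable.mono (hUi.mono_set inter_subset_left) (hum i).aestronglyMeasurable ?_
    filter_upwards [ae_restrict_of_ae_restrict_of_subset inter_subset_right hvae] with y hy
    rw [hy]
    exact PiLp.norm_apply_le _ i
  refine ⟨fun i x => v' x i, Ω.indicator fun x => ‖G' x‖ₑ, hFm,
    fun x hx => indicator_of_notMem hx _, ?_, fun i => ?_, fun i => ⟨hum i, hu i, ?_⟩⟩
  · filter_upwards [hGae, ae_restrict_mem hΩ] with x hx hxΩ
    rw [indicator_of_mem hxΩ, hx]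
  · filter_upwards [hvae] with x hx
    rw [hx]
  · refine hasConvexPoincare_of_weak (hum i) (hu i) (g := fun j x => G' x (i, j))
      (fun j x hx => ?_) hFm hΩ fun φ hφ hφc hφΩ j => ?_
    · rw [indicator_of_mem hx, enorm_le_iff_norm_le]
      exact PiLp.norm_apply_le _ (i, j)
    · have h1 := h.integral_eq φ hφ hφc hφΩ i j
      have h2 : ∫ x in Ω, v' x i * fderiv ℝ φ x (EuclideanSpace.single j 1) =
          ∫ x in Ω, v x i * fderiv ℝ φ x (EuclideanSpace.single j 1) :=
        integral_congr_ae (by filter_upwards [hvae] with x hx; rw [hx])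
      have h3 : ∫ x in Ω, G' x (i, j) * φ x = ∫ x in Ω, G x (i, j) * φ x :=
        integral_congr_ae (by filter_upwards [hGae] with x hx; rw [hx])
      rw [h2, h3, h1]

/-- Lipschitz truncation at a good level, on domains where the pointwise estimate holds. -/
theorem exists_lipschitz_truncation {p : ℝ} (hn : 1 ≤ n) (hm : 1 ≤ m) (hp : 1 < p) {B : ℝ≥0∞}
    (hB : B ≠ ⊤) :
    ∃ C : ℝ, 0 < C ∧ ∀ Ω T : Set 𝔼, IsOpen Ω → IsOpen T → Convex ℝ T → Ω ⊆ T →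
      (∀ (u : 𝔼 → ℝ) (F : 𝔼 → ℝ≥0∞), Measurable u → LocallyIntegrableOn u Ω →
        HasConvexPoincare volume (2 ^ (n + 1) * n) Ω u F →
        HasHajlaszBound volume (volume.restrict T) B Ω u F) →
      ∀ a A : ℝ, 0 < a → a < A →
        ∀ (v : 𝔼 → EuclideanSpace ℝ (Fin m)) (G : 𝔼 → EuclideanSpace ℝ (Fin m × Fin n)),
          HasWeakGradient Ω v G → MemLp G (ENNReal.ofReal p) (volume.restrict Ω) →
          ∃ lam ∈ Icc a A,
            ∃ (w : 𝔼 → EuclideanSpace ℝ (Fin m)) (H : 𝔼 → EuclideanSpace ℝ (Fin m × Fin n)),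
              (∀ x y, dist (w x) (w y) ≤ lam * dist x y) ∧
              HasWeakGradient Ω w H ∧ (∀ x, ‖H x‖ ≤ lam) ∧
              ENNReal.ofReal (lam ^ p) * volume {x | x ∈ Ω ∧ w x ≠ v x} ≤
                ENNReal.ofReal (C / Real.log (A / a)) *
                  ∫⁻ x in Ω, ENNReal.ofReal (‖G x‖ ^ p) := by
  set k : ℝ := m * n with hk
  have hk1 : 0 < k := by positivity
  set b : ℝ := B.toReal with hb
  have hb0 : 0 ≤ b := ENNReal.toReal_nonneg
  -- The 2 absorbs the doubled level in the weak type inequality, and b + 1 absorbs B while avoiding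
  -- division by zero. The factor k = m n gives each component Lipschitz constant λ/k, so that crude
  -- summation over matrix entries costs nothing.
  set c : ℝ := 1 / (2 * (b + 1) * k) with hc
  have hc0 : 0 < c := by positivity
  have hp1 : 0 < p - 1 := by linarith
  refine ⟨5 ^ n / (c ^ p * (p - 1)) + 1, by positivity,
    fun Ω T hΩ hT hTc hΩT hH a A ha haA v G hvG hG => ?_⟩
  obtain ⟨u, F, hFm, hF0, hFG, huv, hu⟩ := hvG.exists_measurable hΩ.measurableSet
  set ν := volume.restrict T with hν
  have hFint : ∫⁻ x, F x ^ p ∂ν = ∫⁻ x in Ω, ENNReal.ofReal (‖G x‖ ^ p) := by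
    have h1 : ∫⁻ x, F x ^ p ∂ν = ∫⁻ x in Ω, F x ^ p ∂ν := by
      rw [← lintegral_indicator hΩ.measurableSet]
      refine lintegral_congr fun x => ?_
      by_cases hx : x ∈ Ω
      · rw [indicator_of_mem hx]
      · rw [indicator_of_notMem hx, hF0 x hx, ENNReal.zero_rpow_of_pos (by linarith)]
    rw [h1, hν, Measure.restrict_restrict hΩ.measurableSet, inter_eq_left.2 hΩT]
    refine lintegral_congr_ae ?_
    filter_upwards [hFG] with x hx
    rw [hx, ← ofReal_norm, ENNReal.ofReal_rpow_of_nonneg (norm_nonneg _) (by linarith)]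
  have hJ : ∫⁻ x, F x ^ p ∂ν ≠ ⊤ := by
    rw [hFint]
    have h1 := lintegral_rpow_enorm_lt_top_of_eLpNorm_lt_top
      (by simpa using (by linarith : 0 < p)) ENNReal.ofReal_ne_top hG.2
    rw [ENNReal.toReal_ofReal (by linarith)] at h1
    refine (lt_of_eq_of_lt (lintegral_congr fun x => ?_) h1).ne
    rw [← ofReal_norm, ENNReal.ofReal_rpow_of_nonneg (norm_nonneg _) (by linarith)]
  set bad : ℝ → Set 𝔼 := fun s => {x ∈ Ω | ¬ MaximalLE ν F (2 * ENNReal.ofReal (c * s)) x}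
  obtain ⟨lam, hlam, hest⟩ := exists_level (ν := ν) hFm hp hc0 (D := 5 ^ n) (by positivity)
    (φ := fun s => ν (bad s)) (fun s _ => by
      refine mul_measure_le_setLIntegral_of_not_maximalLE hFm (fun x hx r _ => ?_)
        fun x hx => hx.2
      have := hTc.restrict_closedBall_mul_le volume (hΩT hx.1) (t := 5) (by norm_num) r
      rwa [finrank_euclideanSpace_fin] at this) hJ ha haA
  have hlam0 : 0 < lam := ha.trans_le hlam.1
  choose N hN hNest using fun i => hH (u i) F (hu i).1 (hu i).2.1 (hu i).2.2
  set K : NNReal := ⟨lam / k, by positivity⟩ with hK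
  set S : Set 𝔼 := {x ∈ Ω | (∀ i, x ∉ N i) ∧ MaximalLE ν F (2 * ENNReal.ofReal (c * lam)) x}
  have hlip : ∀ i, LipschitzOnWith K (u i) S := by
    intro i x hx y hy
    have h1 := hNest i x ⟨hx.1, hx.2.1 i⟩ y ⟨hy.1, hy.2.1 i⟩ _ hx.2.2 hy.2.2
    rw [edist_eq_enorm_sub, edist_dist x y]
    refine h1.trans ?_
    gcongr
    rw [← ENNReal.ofReal_toReal hB, ← ENNReal.ofReal_ofNat, ← ENNReal.ofReal_mul zero_le_two,
      ← ENNReal.ofReal_mul hb0, ← ENNReal.ofReal_coe_nnreal]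
    apply ENNReal.ofReal_le_ofReal
    show b * (2 * (c * lam)) ≤ lam / k
    have h2 : b * (2 * (c * lam)) = b / (b + 1) * (lam / k) := by
      rw [hc]; field_simp
    rw [h2]
    refine mul_le_of_le_one_left (by positivity) ?_
    rw [div_le_one (by positivity)]
    linarith
  -- McShane extension, one component at a time.
  choose w hwlip hweq using fun i => (hlip i).extend_real
  obtain ⟨H, hHw, hHb⟩ := exists_hasWeakGradient_of_lipschitz hwlip Ω
  refine ⟨lam, hlam, fun x => WithLp.toLp 2 fun i => w i x, H, fun x y => ?_, hHw, fun x => ?_, ?_⟩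
  · rw [dist_eq_norm]
    refine (EuclideanSpace.norm_le_sum _).trans ?_
    have h1 : ∀ i, ‖(WithLp.toLp 2 (fun i => w i x) - WithLp.toLp 2 (fun i => w i y) :
        EuclideanSpace ℝ (Fin m)) i‖ ≤ K * dist x y := fun i => by
      have := (hwlip i).dist_le_mul x y
      rwa [dist_eq_norm] at this
    refine (Finset.sum_le_sum fun i _ => h1 i).trans ?_
    rw [Finset.sum_const, Finset.card_univ, Fintype.card_fin, nsmul_eq_mul]
    show (m : ℝ) * (lam / k * dist x y) ≤ _
    have h2 : (m : ℝ) * (lam / k * dist x y) = lam * dist x y / n := by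
      rw [hk]; field_simp
    rw [h2]
    exact div_le_self (by positivity) (by exact_mod_cast hn)
  · refine (hHb x).trans (le_of_eq ?_)
    show (m : ℝ) * n * (lam / k) = lam
    rw [← hk]; field_simp
  · rw [← hFint]
    refine le_trans ?_ hest
    gcongr _ * ?_
    -- Disagreement occurs only where the maximal function is too large, on the exceptional sets of
    -- the pointwise estimate, or where the measurable representative differs from v; the last two
    -- are null.
    have hsub : {x | x ∈ Ω ∧ (WithLp.toLp 2 fun i => w i x : EuclideanSpace ℝ (Fin m)) ≠ v x} ⊆
        bad lam ∪ ((⋃ i, N i) ∪ ⋃ i, {x | ¬ (x ∈ Ω → u i x = v x i)}) := by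
      rintro x ⟨hxΩ, hne⟩
      by_contra hx
      simp only [mem_union, mem_iUnion, not_or, not_exists, mem_ofPred_eq, not_not] at hx
      obtain ⟨hx1, hx2, hx3⟩ := hx
      apply hne
      have hgood : MaximalLE ν F (2 * ENNReal.ofReal (c * lam)) x := by
        by_contra h
        exact hx1 ⟨hxΩ, h⟩
      ext i
      rw [← hx3 i hxΩ]
      exact (hweq i ⟨hxΩ, hx2, hgood⟩).symm
    have hnull : volume ((⋃ i, N i) ∪ ⋃ i, {x | ¬ (x ∈ Ω → u i x = v x i)}) = 0 := by
      rw [measure_union_null_iff]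
      refine ⟨measure_iUnion_null hN, measure_iUnion_null fun i => ?_⟩
      exact (ae_restrict_iff' hΩ.measurableSet).1 (huv i)
    calc volume {x | x ∈ Ω ∧ (WithLp.toLp 2 fun i => w i x : EuclideanSpace ℝ (Fin m)) ≠ v x}
        ≤ volume (bad lam) + 0 := by
          rw [← hnull]
          exact (measure_mono hsub).trans (measure_union_le _ _)
      _ = ν (bad lam) := by
          rw [add_zero, hν, Measure.restrict_apply' hT.measurableSet,
            inter_eq_left.2 fun x hx => hΩT hx.1]

/-- On convex domains, the constant of the pointwise estimate depends only on the dimension. -/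
theorem exists_hajlasz_constant_of_convex : ∃ B : ℝ≥0∞, B ≠ ⊤ ∧
    ∀ Ω : Set 𝔼, IsOpen Ω → Convex ℝ Ω →
    ∀ (u : 𝔼 → ℝ) (F : 𝔼 → ℝ≥0∞), Measurable u → LocallyIntegrableOn u Ω →
      HasConvexPoincare volume (2 ^ (n + 1) * n) Ω u F →
      HasHajlaszBound volume (volume.restrict Ω) B Ω u F := by
  refine ⟨_, ?_, fun Ω hΩ hconv u F hum hu hP => hconv.hasHajlaszBound hΩ hum hu hP⟩
  finiteness

end Truncation

/-! ### Thin strips and conclusion -/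

theorem isOpen_thinStrip (L h : ℝ) : IsOpen (thinStrip L h) := by
  have h0 : Continuous fun x : EuclideanSpace ℝ (Fin 2) => x 0 := by fun_prop
  have h1 : Continuous fun x : EuclideanSpace ℝ (Fin 2) => x 1 := by fun_prop
  exact (isOpen_lt continuous_const h0).inter ((isOpen_lt h0 continuous_const).inter
    ((isOpen_lt continuous_const h1).inter (isOpen_lt h1 continuous_const)))

theorem convex_thinStrip (L h : ℝ) : Convex ℝ (thinStrip L h) := by
  have hl : ∀ i : Fin 2, IsLinearMap ℝ fun x : EuclideanSpace ℝ (Fin 2) => x i := fun i =>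
    ⟨fun _ _ => rfl, fun _ _ => rfl⟩
  exact (convex_halfSpace_gt (hl 0) _).inter ((convex_halfSpace_lt (hl 0) _).inter
    ((convex_halfSpace_gt (hl 1) _).inter (convex_halfSpace_lt (hl 1) _)))

theorem isBounded_thinStrip (L h : ℝ) : Bornology.IsBounded (thinStrip L h) := by
  refine (isBounded_iff_forall_norm_le).2 ⟨|L| + |h|, fun x hx => ?_⟩
  obtain ⟨h0, h1, h2, h3⟩ := hx
  refine (EuclideanSpace.norm_le_sum x).trans ?_
  rw [Fin.sum_univ_two, Real.norm_eq_abs, Real.norm_eq_abs]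
  have h4 : |x 0| ≤ |L| := abs_le_abs_of_nonneg h0.le h1.le
  have h5 : |x 1| ≤ |h| := abs_le.2 ⟨by linarith [le_abs_self h], by linarith [le_abs_self h]⟩
  linarith

theorem lemma4p3 :
    (∀ (n m : ℕ) (p : ℝ), 2 ≤ n → 1 ≤ m → 1 < p →
      ∀ Ω : Set (EuclideanSpace ℝ (Fin n)), (IsBoundedLipschitzDomain Ω ∨ Ω = Set.univ) →
      ∃ C : ℝ, 0 < C ∧ ∀ a A : ℝ, 0 < a → a < A →
        ∀ (v : EuclideanSpace ℝ (Fin n) → EuclideanSpace ℝ (Fin m))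
          (G : EuclideanSpace ℝ (Fin n) → EuclideanSpace ℝ (Fin m × Fin n)),
          HasWeakGradient Ω v G → MemLp G (ENNReal.ofReal p) (volume.restrict Ω) →
          ∃ lam ∈ Set.Icc a A,
            ∃ (w : EuclideanSpace ℝ (Fin n) → EuclideanSpace ℝ (Fin m))
              (H : EuclideanSpace ℝ (Fin n) → EuclideanSpace ℝ (Fin m × Fin n)),
              (∀ x ∈ Ω, ∀ y ∈ Ω, dist (w x) (w y) ≤ lam * dist x y) ∧
              HasWeakGradient Ω w H ∧
              (∀ᵐ x ∂(volume.restrict Ω), ‖H x‖ ≤ lam) ∧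
              ENNReal.ofReal (lam ^ p) * volume {x | x ∈ Ω ∧ w x ≠ v x} ≤
                ENNReal.ofReal (C / Real.log (A / a)) * ∫⁻ x in Ω, ENNReal.ofReal (‖G x‖ ^ p)) ∧
    (∀ L : ℝ, 0 < L →
      ∃ C : ℝ, 0 < C ∧ ∀ h : ℝ, 0 < h → ∀ a A : ℝ, 0 < a → a < A →
        ∀ (u : EuclideanSpace ℝ (Fin 2) → EuclideanSpace ℝ (Fin 2))
          (G : EuclideanSpace ℝ (Fin 2) → EuclideanSpace ℝ (Fin 2 × Fin 2)),
          MemLp u 2 (volume.restrict (thinStrip L h)) →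
          HasWeakGradient (thinStrip L h) u G →
          MemLp G 2 (volume.restrict (thinStrip L h)) →
          ∃ lam ∈ Set.Icc a A,
            ∃ (v : EuclideanSpace ℝ (Fin 2) → EuclideanSpace ℝ (Fin 2))
              (H : EuclideanSpace ℝ (Fin 2) → EuclideanSpace ℝ (Fin 2 × Fin 2)),
              (∀ x ∈ thinStrip L h, ∀ y ∈ thinStrip L h, dist (v x) (v y) ≤ lam * dist x y) ∧
              MemLp v ⊤ (volume.restrict (thinStrip L h)) ∧
              HasWeakGradient (thinStrip L h) v H ∧
              (∀ᵐ x ∂(volume.restrict (thinStrip L h)), ‖H x‖ ≤ lam) ∧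
              ENNReal.ofReal (lam ^ 2) * volume {x | x ∈ thinStrip L h ∧ u x ≠ v x} ≤
                ENNReal.ofReal (C / Real.log (A / a)) *
                  ∫⁻ x in thinStrip L h, ENNReal.ofReal (‖G x‖ ^ 2)) := by
  refine ⟨fun n m p hn hm hp Ω hΩ => ?_, fun L _ => ?_⟩
  · have key : ∃ (T : Set (EuclideanSpace ℝ (Fin n))) (B : ℝ≥0∞), B ≠ ⊤ ∧ IsOpen Ω ∧ IsOpen T ∧
        Convex ℝ T ∧ Ω ⊆ T ∧
        ∀ (u : EuclideanSpace ℝ (Fin n) → ℝ) (F : EuclideanSpace ℝ (Fin n) → ℝ≥0∞),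
          Measurable u → LocallyIntegrableOn u Ω →
          HasConvexPoincare volume (2 ^ (n + 1) * n) Ω u F →
          HasHajlaszBound volume (volume.restrict T) B Ω u F := by
      rcases hΩ with hΩ | rfl
      · obtain ⟨B, hB, hest⟩ := exists_hasHajlaszBound_of_localCone
          (μ := (volume : Measure (EuclideanSpace ℝ (Fin n)))) (C := 2 ^ (n + 1) * n)
          (by finiteness) hΩ.isOpen hΩ.isConnected.isPreconnected hΩ.isBounded
          fun x hx => hΩ.hasLocalCone hx
        -- As Ω need not be convex, averages are taken over full balls, with F extended by zero.
        refine ⟨univ, B, hB, hΩ.isOpen, isOpen_univ, convex_univ, subset_univ _, ?_⟩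
        rwa [Measure.restrict_univ]
      · obtain ⟨B, hB, hest⟩ := exists_hajlasz_constant_of_convex (n := n)
        exact ⟨univ, B, hB, isOpen_univ, isOpen_univ, convex_univ, subset_rfl,
          hest _ isOpen_univ convex_univ⟩
    obtain ⟨T, B, hB, hΩo, hTo, hTc, hΩT, hH⟩ := key
    obtain ⟨C, hC, h⟩ := exists_lipschitz_truncation (n := n) (by omega) hm hp hB
    refine ⟨C, hC, fun a A ha haA v G hvG hG => ?_⟩
    obtain ⟨lam, hlam, w, H, h1, h2, h3, h4⟩ := h Ω T hΩo hTo hTc hΩT hH a A ha haA v G hvG hG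
    exact ⟨lam, hlam, w, H, fun x _ y _ => h1 x y, h2, Filter.Eventually.of_forall h3, h4⟩
  -- Only openness and convexity of the strip enter the truncation estimate, so the constant is
  -- fixed before h and is in fact independent of L too.
  · obtain ⟨B, hB, hest⟩ := exists_hajlasz_constant_of_convex (n := 2)
    obtain ⟨C, hC, h⟩ := exists_lipschitz_truncation (n := 2) (m := 2) (p := 2) one_le_two
      one_le_two one_lt_two hB
    refine ⟨C, hC, fun h' _ a A ha haA u G _ huG hG => ?_⟩
    have hopen := isOpen_thinStrip L h'
    have hconv := convex_thinStrip L h'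
    obtain ⟨lam, hlam, w, H, h1, h2, h3, h4⟩ := h _ _ hopen hopen hconv subset_rfl
      (hest _ hopen hconv) a A ha haA u G huG (by rwa [ENNReal.ofReal_ofNat])
    refine ⟨lam, hlam, w, H, fun x _ y _ => h1 x y, ?_, h2, Filter.Eventually.of_forall h3, ?_⟩
    · have hlip : LipschitzWith lam.toNNReal w := LipschitzWith.of_dist_le' h1
      obtain ⟨M, hM⟩ := isBounded_iff_forall_norm_le.1 (hlip.isBounded_image (isBounded_thinStrip L h'))
      refine memLp_top_of_bound hlip.continuous.aestronglyMeasurable M ?_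
      filter_upwards [ae_restrict_mem hopen.measurableSet] with x hx
      exact hM _ (mem_image_of_mem _ hx)
    · simpa only [Real.rpow_two, ne_comm] using h4
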